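/- Let $(X_k)_{k\ge 1}$ be independent identically distributed real random variables with $E[X_k]=0$ and $E[X_k^2]=1$, let $F$ be their common cumulative distribution function, and assume that the generalized inverse $F^{-1}(u):=\inf\{s\in\mathbb{R} : F(s)\ge u\}$ is continuously differentiable on $(0,1)$. Let $$\varphi_X(y):=-\frac{1}{F'(y)}\int_{-\infty}^y x\,dF(x)$$ be the Stein kernel of $X_1$ (with $\varphi_X(y):=0$ where $F$ has no finite non-zero derivative). Let $A=(a_{k,l})_{1\le k,l\le n}$ be a real symmetric matrix with vanishing diagonal such that the quadratic form $$Q_n:=\sum_{1\le k,l\le n}a_{k,l}X_kX_l$$ is normalized by $E[Q_n^2]=1$, and put $L_n^2:=\max_{1\le k\le n}\sum_{l=1}^n a_{k,l}^2$. Let $\mathcal N$ be a standard normal random variable, and let $d_W(X,Y):=\sup_h|E[h(X)]-E[h(Y)]|$, with the supremum over all real functions $h$ with Lipschitz constant at most $1$, and $d_{TV}(X,Y):=\sup_B|P(X\in B)-P(Y\in B)|$, with the supremum over all Borel sets $B\subset\mathbb{R}$. Then $$d_W(Q_n,\mathcal N)\le 4\sqrt{E[\varphi_X(X_1)^2]\,(2+E[X_1^4])\,L_n^2+2\sum_{1\le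 q,l\le n}\Big(\sum_{k=1}^n a_{k,q}a_{k,l}\Big)^2-\sum_{k=1}^n\Big(\sum_{l=1}^{k-1}a_{k,l}^2\Big)^2}$$ and $$d_{TV}(Q_n,\mathcal N)\le 8\sqrt{E[\varphi_X(X_1)^2]\,(2+E[X_1^4])\,L_n^2+2\sum_{1\le q,l\le n}\Big(\sum_{k=1}^n a_{k,q}a_{k,l}\Big)^2-\sum_{k=1}^n\Big(\sum_{l=1}^{k-1}a_{k,l}^2\Big)^2},$$ where the right-hand sides are $+\infty$ if $E[\varphi_X(X_1)^2]$ or $E[X_1^4]$ is infinite. -/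

import Mathlib

open MeasureTheory ProbabilityTheory
open scoped ENNReal

namespace SteinQuadForm

noncomputable section

/-- Wasserstein distance between two laws on the real line: the supremum of
`|∫ h dμ - ∫ h dν|` over all real functions `h` with Lipschitz constant at most `1`
(meant for laws with a finite first moment). -/
def wassersteinDist (μ ν : Measure ℝ) : ℝ≥0∞ :=
  ⨆ (h : ℝ → ℝ) (_ : LipschitzWith 1 h), ENNReal.ofReal |∫ x, h x ∂μ - ∫ x, h x ∂ν|

/-- Total variation distance between two laws on the real line: the supremum of
`|μ A - ν A|` over all Borel sets `A`. -/
def totalVariationDist (μ ν : Measure ℝ) : ℝ≥0∞ :=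
  ⨆ (A : Set ℝ) (_ : MeasurableSet A), ENNReal.ofReal |μ.real A - ν.real A|

/-- Generalized inverse of the cumulative distribution function `F` of the law `μ`:
`F⁻¹(u) = inf {s : F(s) ≥ u}`, for `0 < u < 1`. -/
def quantile (μ : Measure ℝ) (u : ℝ) : ℝ :=
  sInf {s : ℝ | u ≤ cdf μ s}

/-- Stein kernel of a centered law `μ` with cumulative distribution function `F`:
`φ(y) = -(1 / F'(y)) ∫_{-∞}^y x dF(x)`. -/
def steinKernel (μ : Measure ℝ) (y : ℝ) : ℝ :=
  -(1 / deriv (cdf μ) y) * ∫ x in Set.Iic y, x ∂μ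

variable {n : ℕ}

/-- The quadratic form `Q_n = ∑_{k,l} a_{k,l} X_k X_l`. -/
def quadForm {Ω : Type*} (a : Matrix (Fin n) (Fin n) ℝ) (X : ℕ → Ω → ℝ) (ω : Ω) : ℝ :=
  ∑ k, ∑ l, a k l * X k ω * X l ω

/-- `L_n² = max_k ∑_l a_{k,l}²`. -/
def maxRowSq (a : Matrix (Fin n) (Fin n) ℝ) : ℝ :=
  ⨆ k, ∑ l, a k l ^ 2

/-- `2 ∑_{q,l} (∑_k a_{k,q} a_{k,l})² - ∑_k (∑_{l<k} a_{k,l}²)²`. -/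
def contractionTerm (a : Matrix (Fin n) (Fin n) ℝ) : ℝ :=
  2 * ∑ q, ∑ l, (∑ k, a k q * a k l) ^ 2 - ∑ k, (∑ l with l < k, a k l ^ 2) ^ 2

/-- The contraction term of a symmetric matrix is nonnegative, so that its truncation
`ENNReal.ofReal (contractionTerm a)` loses nothing. -/
theorem contractionTerm_nonneg (a : Matrix (Fin n) (Fin n) ℝ) (ha : a.IsSymm) :
    0 ≤ contractionTerm a := by
  have h1 : ∑ k, (∑ l with l < k, a k l ^ 2) ^ 2 ≤
      ∑ q, ∑ l, (∑ k, a k q * a k l) ^ 2 := by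
    refine Finset.sum_le_sum fun q _ => ?_
    refine le_trans ?_ (Finset.single_le_sum (f := fun l => (∑ k, a k q * a k l) ^ 2)
      (fun _ _ => sq_nonneg _) (Finset.mem_univ q))
    have h2 : ∑ k, a k q * a k q = ∑ l, a q l ^ 2 := by
      refine Finset.sum_congr rfl fun k _ => ?_
      rw [ha.apply q k, sq]
    simp only [h2]
    have h3 : ∑ l with l < q, a q l ^ 2 ≤ ∑ l, a q l ^ 2 :=
      Finset.sum_le_sum_of_subset_of_nonneg (Finset.filter_subset _ _)
        fun _ _ _ => sq_nonneg _
    have h4 : 0 ≤ ∑ l with l < q, a q l ^ 2 := Finset.sum_nonneg fun _ _ => sq_nonneg _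
    exact pow_le_pow_left₀ h4 h3 2
  have h5 : 0 ≤ ∑ q, ∑ l, (∑ k, a k q * a k l) ^ 2 :=
    Finset.sum_nonneg fun _ _ => Finset.sum_nonneg fun _ _ => sq_nonneg _
  unfold contractionTerm
  linarith

/-- The root `√(E[φ(X)²] (2 + E[X⁴]) L_n² + contractionTerm a)`, where `X` has law `μ`.
Both expectations are computed in `[0, ∞]`, so the root is `∞` if one of them is infinite
(and `L_n > 0`). -/
def boundRoot (μ : Measure ℝ) (a : Matrix (Fin n) (Fin n) ℝ) : ℝ≥0∞ :=
  ((∫⁻ x, ENNReal.ofReal (steinKernel μ x ^ 2) ∂μ)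
      * (2 + ∫⁻ x, ENNReal.ofReal (x ^ 4) ∂μ) * ENNReal.ofReal (maxRowSq a)
    + ENNReal.ofReal (contractionTerm a)) ^ (1 / 2 : ℝ)

end

end SteinQuadForm

namespace SteinQuadForm

noncomputable section

open Set Filter Topology

lemma quantile_set_bddBelow (μ : Measure ℝ) {u : ℝ} (hu : 0 < u) :
    BddBelow {s : ℝ | u ≤ cdf μ s} := by
  obtain ⟨b, hb⟩ := ((tendsto_cdf_atBot μ).eventually (gt_mem_nhds hu)).exists
  refine ⟨b, fun s hs => ?_⟩
  by_contra! h
  exact absurd (le_trans hs (monotone_cdf μ h.le)) (not_le.2 hb)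

lemma quantile_set_nonempty (μ : Measure ℝ) {u : ℝ} (hu : u < 1) :
    {s : ℝ | u ≤ cdf μ s}.Nonempty := by
  obtain ⟨b, hb⟩ := ((tendsto_cdf_atTop μ).eventually (lt_mem_nhds hu)).exists
  exact ⟨b, hb.le⟩

lemma le_cdf_quantile (μ : Measure ℝ) [IsProbabilityMeasure μ] {u : ℝ}
    (hu : u ∈ Ioo (0 : ℝ) 1) : u ≤ cdf μ (quantile μ u) := by
  have hc : Tendsto (cdf μ) (𝓝[>] (quantile μ u)) (𝓝 (cdf μ (quantile μ u))) :=
    ((cdf μ).right_continuous _).mono_left (nhdsWithin_mono _ Ioi_subset_Ici_self)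
  refine ge_of_tendsto hc ?_
  filter_upwards [self_mem_nhdsWithin] with s hs
  obtain ⟨t, ht, hts⟩ := exists_lt_of_csInf_lt (quantile_set_nonempty μ hu.2) hs
  exact le_trans ht (monotone_cdf μ hts.le)

lemma quantile_le_iff (μ : Measure ℝ) [IsProbabilityMeasure μ] {u : ℝ}
    (hu : u ∈ Ioo (0 : ℝ) 1) (s : ℝ) :
    quantile μ u ≤ s ↔ u ≤ cdf μ s :=
  ⟨fun h => (le_cdf_quantile μ hu).trans (monotone_cdf μ h),
    fun h => csInf_le (quantile_set_bddBelow μ hu.1) h⟩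

lemma monotoneOn_quantile (μ : Measure ℝ) [IsProbabilityMeasure μ] :
    MonotoneOn (quantile μ) (Ioo 0 1) := fun _ hu _ hv huv =>
  (quantile_le_iff μ hu _).2 (huv.trans (le_cdf_quantile μ hv))

lemma aemeasurable_quantile (μ : Measure ℝ) [IsProbabilityMeasure μ] :
    AEMeasurable (quantile μ) (volume.restrict (Ioo (0 : ℝ) 1)) :=
  aemeasurable_restrict_of_monotoneOn measurableSet_Ioo (monotoneOn_quantile μ)

lemma map_quantile (μ : Measure ℝ) [IsProbabilityMeasure μ] :
    (volume.restrict (Ioo (0 : ℝ) 1)).map (quantile μ) = μ := by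
  have hfin : IsFiniteMeasure ((volume.restrict (Ioo (0 : ℝ) 1)).map (quantile μ)) := by
    infer_instance
  refine Measure.ext_of_Iic _ _ fun s => ?_
  rw [Measure.map_apply_of_aemeasurable (aemeasurable_quantile μ) measurableSet_Iic,
    Measure.restrict_apply₀' measurableSet_Ioo.nullMeasurableSet]
  have h : quantile μ ⁻¹' Iic s ∩ Ioo 0 1 = Iic (cdf μ s) ∩ Ioo 0 1 := by
    ext u
    simp only [mem_inter_iff, mem_preimage, mem_Iic]
    exact and_congr_left fun hu => quantile_le_iff μ hu s
  rw [h, ← ofReal_cdf]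
  have h1 := cdf_le_one μ s
  apply le_antisymm
  · refine (measure_mono (t := Ioc 0 (cdf μ s)) fun u hu => ⟨hu.2.1, hu.1⟩).trans ?_
    simp
  · refine le_trans ?_ (measure_mono (s := Ioo 0 (cdf μ s))
      fun u hu => ⟨hu.2.le, hu.1, hu.2.trans_le h1⟩)
    simp

lemma integral_quantile (μ : Measure ℝ) [IsProbabilityMeasure μ] {f : ℝ → ℝ}
    (hf : AEStronglyMeasurable f μ) :
    ∫ u in Ioo (0 : ℝ) 1, f (quantile μ u) = ∫ x, f x ∂μ := by
  conv_rhs => rw [← map_quantile μ]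
  rw [integral_map (aemeasurable_quantile μ)]
  rwa [map_quantile μ]

lemma integrableOn_quantile (μ : Measure ℝ) [IsProbabilityMeasure μ] {f : ℝ → ℝ}
    (hf : Integrable f μ) :
    IntegrableOn (fun u => f (quantile μ u)) (Ioo (0 : ℝ) 1) := by
  rw [← map_quantile μ] at hf
  exact hf.comp_aemeasurable (aemeasurable_quantile μ)

lemma setIntegral_Iic_quantile (μ : Measure ℝ) [IsProbabilityMeasure μ] {u : ℝ}
    (hu : u ∈ Ioo (0 : ℝ) 1) (hc : cdf μ (quantile μ u) = u) :
    ∫ x in Iic (quantile μ u), x ∂μ = ∫ v in Ioo 0 u, quantile μ v := by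
  have h1 : ∫ x in Iic (quantile μ u), x ∂μ = ∫ x, (Iic (quantile μ u)).indicator id x ∂μ := by
    rw [integral_indicator measurableSet_Iic]; rfl
  rw [h1, ← integral_quantile μ (by
    exact (measurable_id.indicator measurableSet_Iic).aestronglyMeasurable)]
  have h2 : ∀ v ∈ Ioo (0 : ℝ) 1, (Iic (quantile μ u)).indicator id (quantile μ v)
      = (Iic u).indicator (quantile μ) v := by
    intro v hv
    by_cases hvu : v ≤ u
    · rw [indicator_of_mem (s := Iic u) hvu, indicator_of_mem]
      · rfl
      · rw [mem_Iic, quantile_le_iff μ hv, hc]; exact hvu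
    · rw [indicator_of_notMem (s := Iic u) hvu, indicator_of_notMem]
      rw [mem_Iic, quantile_le_iff μ hv, hc]; exact hvu
  rw [setIntegral_congr_fun measurableSet_Ioo h2, setIntegral_indicator measurableSet_Iic,
    ← integral_Ioc_eq_integral_Ioo]
  congr 2
  ext v
  simp only [mem_inter_iff, mem_Ioo, mem_Iic, mem_Ioc]
  exact ⟨fun h => ⟨h.1.1, h.2⟩, fun h => ⟨⟨h.1, h.2.trans_lt hu.2⟩, h.2⟩⟩

lemma contDiffAt_quantile {μ : Measure ℝ}
    (hs : ContDiffOn ℝ 1 (quantile μ) (Ioo 0 1)) {u : ℝ} (hu : u ∈ Ioo (0 : ℝ) 1) :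
    ContDiffAt ℝ 1 (quantile μ) u :=
  hs.contDiffAt (Ioo_mem_nhds hu.1 hu.2)

lemma hasDerivAt_quantile {μ : Measure ℝ}
    (hs : ContDiffOn ℝ 1 (quantile μ) (Ioo 0 1)) {u : ℝ} (hu : u ∈ Ioo (0 : ℝ) 1) :
    HasDerivAt (quantile μ) (deriv (quantile μ) u) u :=
  ((contDiffAt_quantile hs hu).differentiableAt one_ne_zero).hasDerivAt

lemma continuousAt_deriv_quantile {μ : Measure ℝ}
    (hs : ContDiffOn ℝ 1 (quantile μ) (Ioo 0 1)) {u : ℝ} (hu : u ∈ Ioo (0 : ℝ) 1) :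
    ContinuousAt (deriv (quantile μ)) u :=
  (hs.continuousOn_deriv_of_isOpen isOpen_Ioo le_rfl).continuousAt (Ioo_mem_nhds hu.1 hu.2)

lemma cdf_quantile_of_deriv_ne_zero {μ : Measure ℝ} [IsProbabilityMeasure μ]
    (hs : ContDiffOn ℝ 1 (quantile μ) (Ioo 0 1)) {u : ℝ} (hu : u ∈ Ioo (0 : ℝ) 1)
    (hd : deriv (quantile μ) u ≠ 0) : cdf μ (quantile μ u) = u := by
  by_contra hne
  have hlt : u < cdf μ (quantile μ u) := lt_of_le_of_ne (le_cdf_quantile μ hu) (Ne.symm hne)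
  have hev : quantile μ =ᶠ[𝓝[>] u] fun _ => quantile μ u := by
    filter_upwards [Ioo_mem_nhdsGT (lt_min hlt hu.2)] with v hv
    have hv1 : v ∈ Ioo (0 : ℝ) 1 := ⟨hu.1.trans hv.1, hv.2.trans_le (min_le_right _ _)⟩
    exact le_antisymm ((quantile_le_iff μ hv1 _).2 (hv.2.le.trans (min_le_left _ _)))
      (monotoneOn_quantile μ hu hv1 hv.1.le)
  have h1 : HasDerivWithinAt (quantile μ) 0 (Ioi u) u :=
    (hasDerivWithinAt_const u (Ioi u) (quantile μ u)).congr_of_eventuallyEq hev rfl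
  exact hd ((uniqueDiffWithinAt_Ioi u).eq_deriv _ (hasDerivAt_quantile hs hu).hasDerivWithinAt h1)

lemma hasDerivAt_cdf_of_deriv_ne_zero {μ : Measure ℝ} [IsProbabilityMeasure μ]
    (hs : ContDiffOn ℝ 1 (quantile μ) (Ioo 0 1)) {u : ℝ} (hu : u ∈ Ioo (0 : ℝ) 1)
    (hd : deriv (quantile μ) u ≠ 0) :
    HasDerivAt (cdf μ) (deriv (quantile μ) u)⁻¹ (quantile μ u) := by
  have hstrict : HasStrictDerivAt (quantile μ) (deriv (quantile μ) u) u :=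
    (contDiffAt_quantile hs hu).hasStrictDerivAt one_ne_zero
  have hmap := hstrict.map_nhds_eq hd
  have hcu := cdf_quantile_of_deriv_ne_zero hs hu hd
  have hev : ∀ᶠ v in 𝓝 u, cdf μ (quantile μ v) = v := by
    filter_upwards [(continuousAt_deriv_quantile hs hu).eventually_ne hd,
      Ioo_mem_nhds hu.1 hu.2] with v hv hv1
    exact cdf_quantile_of_deriv_ne_zero hs hv1 hv
  refine HasDerivAt.of_local_left_inverse (f := quantile μ) ?_ ?_ hd ?_
  · rw [ContinuousAt, ← hmap, tendsto_map'_iff, hcu]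
    exact tendsto_id.congr' (hev.mono fun v hv => hv.symm)
  · rw [hcu]; exact hasDerivAt_quantile hs hu
  · rw [← hmap, eventually_map]
    exact hev.mono fun v hv => by rw [hv]

lemma not_differentiableAt_cdf {μ : Measure ℝ} [IsProbabilityMeasure μ]
    (hs : ContDiffOn ℝ 1 (quantile μ) (Ioo 0 1)) {u : ℝ} (hu : u ∈ Ioo (0 : ℝ) 1)
    (hd : deriv (quantile μ) u = 0) : ¬ DifferentiableAt ℝ (cdf μ) (quantile μ u) := by
  intro hF
  have hcu : cdf μ (quantile μ u) = u := by
    refine le_antisymm ?_ (le_cdf_quantile μ hu)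
    refine le_of_tendsto (hF.continuousAt.tendsto.mono_left
      (nhdsWithin_le_nhds (s := Iio (quantile μ u)))) ?_
    filter_upwards [self_mem_nhdsWithin] with s hs'
    by_contra! h
    exact absurd ((quantile_le_iff μ hu s).2 h.le) (not_le.2 hs')
  have hq := hasDerivAt_quantile hs hu
  rw [hd] at hq
  have hcomp := (hF.hasDerivAt.comp u hq).sub (hasDerivAt_id u)
  have hmin : IsLocalMin (cdf μ ∘ quantile μ - id) u := by
    filter_upwards [Ioo_mem_nhds hu.1 hu.2] with v hv
    simp only [Pi.sub_apply, Function.comp_apply, id, hcu, sub_self, sub_nonneg]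
    exact le_cdf_quantile μ hv
  have := hmin.hasDerivAt_eq_zero hcomp
  simp at this

lemma steinKernel_quantile {μ : Measure ℝ} [IsProbabilityMeasure μ]
    (hs : ContDiffOn ℝ 1 (quantile μ) (Ioo 0 1)) {u : ℝ} (hu : u ∈ Ioo (0 : ℝ) 1) :
    steinKernel μ (quantile μ u) = -(∫ v in Ioo 0 u, quantile μ v) * deriv (quantile μ) u := by
  unfold steinKernel
  by_cases hd : deriv (quantile μ) u = 0
  · rw [deriv_zero_of_not_differentiableAt (not_differentiableAt_cdf hs hu hd), hd]
    simp
  · rw [(hasDerivAt_cdf_of_deriv_ne_zero hs hu hd).deriv,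
      setIntegral_Iic_quantile μ hu (cdf_quantile_of_deriv_ne_zero hs hu hd)]
    simp only [one_div, inv_inv]
    ring

lemma measurable_steinKernel (μ : Measure ℝ) [IsProbabilityMeasure μ] :
    Measurable (steinKernel μ) := by
  have h : Measurable fun y : ℝ => ∫ x in Iic y, x ∂μ := by
    have h1 : StronglyMeasurable fun y : ℝ => ∫ x, (Iic y).indicator id x ∂μ := by
      apply StronglyMeasurable.integral_prod_right (f := fun y x : ℝ => (Iic y).indicator id x)
      have : Measurable fun p : ℝ × ℝ => (if p.2 ≤ p.1 then p.2 else 0) :=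
        Measurable.ite (measurableSet_le measurable_snd measurable_fst) measurable_snd
          measurable_const
      exact this.stronglyMeasurable
    convert h1.measurable using 2 with y
    rw [integral_indicator measurableSet_Iic]
    rfl
  unfold steinKernel
  exact ((measurable_const.div (measurable_deriv _)).neg).mul h

end

noncomputable section

open Set Filter Topology

lemma abs_le_of_hasDerivAt_bounded {g g' : ℝ → ℝ} {C : ℝ} (hg : ∀ x, HasDerivAt g (g' x) x)
    (hC : ∀ x, |g' x| ≤ C) (x : ℝ) : |g x| ≤ |g 0| + C * |x| := by
  have h := Convex.norm_image_sub_le_of_norm_hasDerivWithin_le (f := g) (f' := g') (s := univ)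
    (C := C) (x := 0) (y := x) (fun y _ => (hg y).hasDerivWithinAt) (fun y _ => hC y) convex_univ
    (mem_univ _) (mem_univ _)
  simp only [Real.norm_eq_abs, sub_zero] at h
  have := abs_sub_abs_le_abs_sub (g x) (g 0)
  linarith

lemma intervalIntegrable_of_integrableOn_Ioo {f : ℝ → ℝ} (hf : IntegrableOn f (Ioo 0 1)) :
    IntervalIntegrable f volume 0 1 := by
  rw [intervalIntegrable_iff_integrableOn_Ioo_of_le zero_le_one]
  exact hf

lemma tendsto_primitive_zero {b : ℝ → ℝ} (hb : IntervalIntegrable b volume 0 1) :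
    Tendsto (fun u => ∫ v in (0 : ℝ)..u, b v) (𝓝[>] 0) (𝓝 0) := by
  have h := intervalIntegral.continuousOn_primitive_interval' hb (left_mem_uIcc)
  have h1 := (h 0 left_mem_uIcc).tendsto
  rw [intervalIntegral.integral_same] at h1
  refine h1.mono_left ?_
  rw [← nhdsWithin_Ioo_eq_nhdsGT (zero_lt_one' ℝ), uIcc_of_le zero_le_one]
  exact nhdsWithin_mono _ Ioo_subset_Icc_self

lemma tendsto_primitive_one {b : ℝ → ℝ} (hb : IntervalIntegrable b volume 0 1) :
    Tendsto (fun u => ∫ v in u..1, b v) (𝓝[<] 1) (𝓝 0) := by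
  have h := intervalIntegral.continuousOn_primitive_interval' hb (right_mem_uIcc)
  have h1 := (h 1 right_mem_uIcc).tendsto
  rw [intervalIntegral.integral_same] at h1
  have h2 : Tendsto (fun u => ∫ v in u..1, b v) (𝓝[uIcc 0 1] 1) (𝓝 0) := by
    have := h1.neg
    rw [neg_zero] at this
    exact this.congr fun u => (intervalIntegral.integral_symm 1 u).symm
  refine h2.mono_left ?_
  rw [← nhdsWithin_Ioo_eq_nhdsLT (zero_lt_one' ℝ), uIcc_of_le zero_le_one]
  exact nhdsWithin_mono _ Ioo_subset_Icc_self

/-- Products `(∫ G) · r` where `r` is dominated on the domain of integration. -/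
lemma abs_integral_mul_le {G b : ℝ → ℝ} {s t r : ℝ} (hst : s ≤ t)
    (hG : IntervalIntegrable G volume s t) (hb : IntervalIntegrable b volume s t)
    (h : ∀ v ∈ Ioo s t, |G v| * |r| ≤ b v) : |(∫ v in s..t, G v) * r| ≤ ∫ v in s..t, b v := by
  rw [abs_mul]
  calc |∫ v in s..t, G v| * |r| ≤ (∫ v in s..t, |G v|) * |r| := by
        gcongr
        exact intervalIntegral.abs_integral_le_integral_abs hst
    _ = ∫ v in s..t, |G v| * |r| := by rw [intervalIntegral.integral_mul_const]
    _ ≤ ∫ v in s..t, b v := by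
        refine intervalIntegral.integral_mono_on_of_le_Ioo hst (hG.abs.mul_const _) hb h

lemma abs_mono_le {G : ℝ → ℝ} {s t w : ℝ} (h1 : G s ≤ G t) (h2 : G t ≤ G w) :
    |G t| ≤ |G s| + |G w| := by
  rcases abs_cases (G s) with h | h <;> rcases abs_cases (G t) with h' | h' <;>
    rcases abs_cases (G w) with h'' | h'' <;> linarith

theorem integral_mul_eq_integral_steinKernel_mul {μ : Measure ℝ} [IsProbabilityMeasure μ]
    (hs : ContDiffOn ℝ 1 (quantile μ) (Ioo 0 1)) (hx2 : Integrable (fun x => x ^ 2) μ)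
    (hmean : ∫ x, x ∂μ = 0) (hφ : Integrable (steinKernel μ) μ)
    {g g' : ℝ → ℝ} {C : ℝ} (hg : ∀ x, HasDerivAt g (g' x) x)
    (hg' : Continuous g') (hC : ∀ x, |g' x| ≤ C) :
    ∫ x, x * g x ∂μ = ∫ x, steinKernel μ x * g' x ∂μ := by
  set G := quantile μ with hGdef
  have hC0 : 0 ≤ C := (abs_nonneg _).trans (hC 0)
  have hgc : Continuous g := continuous_iff_continuousAt.2 fun x => (hg x).continuousAt
  have hx1 : Integrable (fun x => x) μ :=
    ((memLp_two_iff_integrable_sq measurable_id.aestronglyMeasurable).2 hx2).integrable one_le_two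
  have hG1 := integrableOn_quantile μ hx1
  have hG2 := integrableOn_quantile μ hx2
  have hGi := intervalIntegrable_of_integrableOn_Ioo hG1
  have hxg : Integrable (fun x => x * g x) μ := by
    refine Integrable.mono' ((hx1.abs.const_mul |g 0|).add (hx2.const_mul C))
      (measurable_id.mul hgc.measurable).aestronglyMeasurable (ae_of_all _ fun x => ?_)
    have := mul_le_mul_of_nonneg_left (abs_le_of_hasDerivAt_bounded hg hC x) (abs_nonneg x)
    simp only [Pi.add_apply, Real.norm_eq_abs, abs_mul]
    nlinarith [sq_abs x]
  have hφg : Integrable (fun x => steinKernel μ x * g' x) μ :=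
    hφ.mul_bdd hg'.aestronglyMeasurable (ae_of_all _ hC)
  set c := |G (1 / 2)|
  set b : ℝ → ℝ := fun v => |G v| * (|g 0| + C * c) + C * G v ^ 2 with hb
  have hbi : IntervalIntegrable b volume 0 1 := intervalIntegrable_of_integrableOn_Ioo
    ((hG1.abs.mul_const _).add (hG2.const_mul C))
  have hdom : ∀ u v, |G u| ≤ |G v| + c → |G v| * |g (G u)| ≤ b v := by
    intro u v huv
    have h1 := abs_le_of_hasDerivAt_bounded hg hC (G u)
    have h2 : |g (G u)| ≤ |g 0| + C * (|G v| + c) := h1.trans (by gcongr)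
    have h3 := mul_le_mul_of_nonneg_left h2 (abs_nonneg (G v))
    simp only [hb]
    nlinarith [sq_abs (G v)]
  have hsub : ∀ s t : ℝ, s ∈ Icc (0 : ℝ) 1 → t ∈ Icc (0 : ℝ) 1 → uIcc s t ⊆ uIcc 0 1 := by
    intro s t h1 h2
    rw [uIcc_of_le (zero_le_one' ℝ)]
    exact uIcc_subset_Icc h1 h2
  have hhalf : (1 / 2 : ℝ) ∈ Ioo (0 : ℝ) 1 := by constructor <;> norm_num
  have hmono := monotoneOn_quantile μ
  have h0m : (0 : ℝ) ∈ Icc (0 : ℝ) 1 := by simp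
  have h1m : (1 : ℝ) ∈ Icc (0 : ℝ) 1 := by simp
  have htot : ∫ v in (0 : ℝ)..1, G v = 0 := by
    rw [intervalIntegral.integral_of_le zero_le_one, integral_Ioc_eq_integral_Ioo,
      integral_quantile μ (f := fun x => x) hx1.aestronglyMeasurable, hmean]
  set f : ℝ → ℝ := fun u => (∫ v in (0 : ℝ)..u, G v) * g (G u) with hf
  have hf0 : Tendsto f (𝓝[>] 0) (𝓝 0) := by
    refine squeeze_zero_norm' ?_ (tendsto_primitive_zero hbi)
    filter_upwards [Ioo_mem_nhdsGT hhalf.1] with u hu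
    have hu1 : u ∈ Icc (0 : ℝ) 1 := ⟨hu.1.le, hu.2.le.trans hhalf.2.le⟩
    refine abs_integral_mul_le hu.1.le (hGi.mono_set (hsub _ _ h0m hu1))
      (hbi.mono_set (hsub _ _ h0m hu1)) fun v hv => hdom u v (abs_mono_le ?_ ?_)
    · exact hmono ⟨hv.1, hv.2.trans (hu.2.trans hhalf.2)⟩ ⟨hu.1, hu.2.trans hhalf.2⟩ hv.2.le
    · exact hmono ⟨hu.1, hu.2.trans hhalf.2⟩ hhalf hu.2.le
  have hf1 : Tendsto f (𝓝[<] 1) (𝓝 0) := by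
    refine squeeze_zero_norm' ?_ (tendsto_primitive_one hbi)
    filter_upwards [Ioo_mem_nhdsLT hhalf.2] with u hu
    have hu1 : u ∈ Icc (0 : ℝ) 1 := ⟨hhalf.1.le.trans hu.1.le, hu.2.le⟩
    have hadd := intervalIntegral.integral_add_adjacent_intervals
      (hGi.mono_set (hsub _ _ h0m hu1)) (hGi.mono_set (hsub _ _ hu1 h1m))
    have hneg : f u = -((∫ v in u..1, G v) * g (G u)) := by
      simp only [hf]
      rw [eq_neg_of_add_eq_zero_left (hadd.trans htot)]
      ring
    rw [hneg, norm_neg]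
    refine abs_integral_mul_le hu.2.le (hGi.mono_set (hsub _ _ hu1 h1m))
      (hbi.mono_set (hsub _ _ hu1 h1m)) fun v hv => hdom u v ?_
    have h1 : G (1 / 2) ≤ G u := hmono hhalf ⟨hhalf.1.trans hu.1, hu.2⟩ hu.1.le
    have h2 : G u ≤ G v := hmono ⟨hhalf.1.trans hu.1, hu.2⟩
      ⟨(hhalf.1.trans hu.1).trans hv.1, hv.2⟩ hv.1.le
    linarith [abs_mono_le h1 h2]
  have hderiv : ∀ u ∈ Ioo (0 : ℝ) 1,
      HasDerivAt f (G u * g (G u) - steinKernel μ (G u) * g' (G u)) u := by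
    intro u hu
    have hu1 : u ∈ Icc (0 : ℝ) 1 := ⟨hu.1.le, hu.2.le⟩
    have hI : HasDerivAt (fun u => ∫ v in (0 : ℝ)..u, G v) (G u) u := by
      refine intervalIntegral.integral_hasDerivAt_right (hGi.mono_set (hsub _ _ h0m hu1)) ?_
        (hasDerivAt_quantile hs hu).continuousAt
      exact ContinuousOn.stronglyMeasurableAtFilter isOpen_Ioo hs.continuousOn u hu
    have hgG := (hg (G u)).comp u (hasDerivAt_quantile hs hu)
    refine (hI.mul hgG).congr_deriv ?_
    rw [steinKernel_quantile hs hu, intervalIntegral.integral_of_le hu.1.le,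
      integral_Ioc_eq_integral_Ioo]
    simp only [Function.comp, ← hGdef]
    ring
  have hint1 := integrableOn_quantile μ hxg
  have hint2 := integrableOn_quantile μ hφg
  have key := intervalIntegral.integral_eq_sub_of_hasDerivAt_of_tendsto zero_lt_one hderiv
    (intervalIntegrable_of_integrableOn_Ioo (hint1.sub hint2)) hf0 hf1
  rw [intervalIntegral.integral_of_le zero_le_one, integral_Ioc_eq_integral_Ioo,
    integral_sub hint1 hint2, integral_quantile μ hxg.aestronglyMeasurable,
    integral_quantile μ hφg.aestronglyMeasurable] at key
  linarith

lemma integral_steinKernel {μ : Measure ℝ} [IsProbabilityMeasure μ]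
    (hs : ContDiffOn ℝ 1 (quantile μ) (Ioo 0 1)) (hx2 : Integrable (fun x => x ^ 2) μ)
    (hmean : ∫ x, x ∂μ = 0) (hφ : Integrable (steinKernel μ) μ) :
    ∫ x, steinKernel μ x ∂μ = ∫ x, x ^ 2 ∂μ := by
  have h := integral_mul_eq_integral_steinKernel_mul hs hx2 hmean hφ (g := fun x => x)
    (g' := fun _ => 1) (C := 1) hasDerivAt_id continuous_const (by simp)
  simp only [mul_one] at h
  rw [← h]
  simp only [sq]

end

noncomputable section

open Set Filter Topology

/-- The unnormalized standard Gaussian density. -/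
def gaussWeight (t : ℝ) : ℝ := Real.exp (-(1 / 2) * t ^ 2)

lemma gaussWeight_pos (t : ℝ) : 0 < gaussWeight t := Real.exp_pos _

lemma gaussWeight_le_one (t : ℝ) : gaussWeight t ≤ 1 :=
  Real.exp_le_one_iff.2 (by nlinarith [sq_nonneg t])

lemma gaussWeight_neg (t : ℝ) : gaussWeight (-t) = gaussWeight t := by simp [gaussWeight]

lemma continuous_gaussWeight : Continuous gaussWeight := by unfold gaussWeight; fun_prop

lemma hasDerivAt_gaussWeight (t : ℝ) : HasDerivAt gaussWeight (-t * gaussWeight t) t := by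
  unfold gaussWeight
  refine ((hasDerivAt_pow 2 t).const_mul (-(1 / 2 : ℝ))).exp.congr_deriv ?_
  push_cast
  ring

lemma integrable_gaussWeight : Integrable gaussWeight := integrable_exp_neg_mul_sq (by norm_num)

lemma integrable_mul_gaussWeight : Integrable fun t => t * gaussWeight t :=
  integrable_mul_exp_neg_mul_sq (by norm_num)

lemma two_le_integral_gaussWeight : 2 ≤ ∫ t, gaussWeight t := by
  unfold gaussWeight
  rw [integral_gaussian]
  refine Real.le_sqrt_of_sq_le ?_
  have := Real.pi_gt_three
  linarith

lemma integral_mul_gaussWeight : ∫ t, t * gaussWeight t = 0 := by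
  have h := integral_neg_eq_self (fun t => t * gaussWeight t) volume
  simp only [gaussWeight_neg, neg_mul, integral_neg] at h
  linarith

lemma tendsto_gaussWeight_atTop : Tendsto gaussWeight atTop (𝓝 0) := by
  refine Real.tendsto_exp_atBot.comp ?_
  exact (tendsto_pow_atTop two_ne_zero).const_mul_atTop_of_neg (by norm_num)

lemma integral_gaussianReal_eq (h : ℝ → ℝ) :
    ∫ x, h x ∂(gaussianReal 0 1) = (∫ t, gaussWeight t)⁻¹ * ∫ t, h t * gaussWeight t := by
  rw [integral_gaussianReal_eq_integral_smul one_ne_zero, ← integral_const_mul]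
  have h1 : ∫ t, gaussWeight t = √(2 * Real.pi) := by
    unfold gaussWeight
    rw [integral_gaussian]
    congr 1
    ring
  refine integral_congr_ae (ae_of_all _ fun t => ?_)
  simp only [gaussianPDFReal, h1, smul_eq_mul, NNReal.coe_one, mul_one, sub_zero]
  rw [show -t ^ 2 / 2 = -(1 / 2) * t ^ 2 by ring, gaussWeight]
  ring

lemma integral_Ioi_mul_gaussWeight (x : ℝ) :
    ∫ t in Ioi x, t * gaussWeight t = gaussWeight x := by
  have hl : Tendsto (fun t => -gaussWeight t) atTop (𝓝 0) := by
    simpa using tendsto_gaussWeight_atTop.neg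
  have h := integral_Ioi_of_hasDerivAt_of_tendsto' (a := x) (f := fun t => -gaussWeight t)
    (f' := fun t => t * gaussWeight t)
    (fun t _ => (hasDerivAt_gaussWeight t).fun_neg.congr_deriv (by ring))
    integrable_mul_gaussWeight.integrableOn hl
  simpa using h

lemma integral_Ioi_sub_mul_gaussWeight (x : ℝ) :
    ∫ t in Ioi x, (t - x) * gaussWeight t
      = gaussWeight x - x * ∫ t in Ioi x, gaussWeight t := by
  simp only [sub_mul]
  rw [integral_sub integrable_mul_gaussWeight.integrableOn
    (integrable_gaussWeight.const_mul x).integrableOn, integral_Ioi_mul_gaussWeight,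
    integral_const_mul]

lemma integral_Ioi_sub_mul_gaussWeight_nonneg (x : ℝ) :
    0 ≤ ∫ t in Ioi x, (t - x) * gaussWeight t :=
  setIntegral_nonneg measurableSet_Ioi fun t ht =>
    mul_nonneg (sub_nonneg.2 (le_of_lt ht)) (gaussWeight_pos t).le

/-- Birnbaum's lower bound for the Mills ratio. -/
def birnbaum (x : ℝ) : ℝ := (√(x ^ 2 + 4) - x) / 2

lemma birnbaum_eq (x : ℝ) : birnbaum x ^ 2 = 1 - x * birnbaum x := by
  have := Real.sq_sqrt (by positivity : (0 : ℝ) ≤ x ^ 2 + 4)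
  unfold birnbaum
  nlinarith

lemma birnbaum_pos (x : ℝ) : 0 < birnbaum x := by
  unfold birnbaum
  have := Real.lt_sqrt_of_sq_lt (by linarith : x ^ 2 < x ^ 2 + 4)
  linarith

lemma birnbaum_le_one {x : ℝ} (hx : 0 ≤ x) : birnbaum x ≤ 1 := by
  nlinarith [birnbaum_eq x, mul_nonneg hx (birnbaum_pos x).le, birnbaum_pos x]

lemma hasDerivAt_birnbaum (x : ℝ) :
    HasDerivAt birnbaum (-birnbaum x / √(x ^ 2 + 4)) x := by
  have hpos : 0 < √(x ^ 2 + 4) := Real.sqrt_pos.2 (by positivity)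
  unfold birnbaum
  have h := ((((hasDerivAt_id x).pow 2).add_const 4).sqrt (by simp; positivity)).sub
    (hasDerivAt_id x)
  refine (h.div_const 2).congr_deriv ?_
  simp
  field_simp
  ring

lemma birnbaum_mul_gaussWeight_le {x : ℝ} (hx : 0 ≤ x) :
    birnbaum x * gaussWeight x ≤ ∫ t in Ioi x, gaussWeight t := by
  set g' : ℝ → ℝ := fun t =>
    -birnbaum t / √(t ^ 2 + 4) * gaussWeight t + birnbaum t * (-t * gaussWeight t)
  have hd : ∀ t ∈ Ici x, HasDerivAt (fun t => birnbaum t * gaussWeight t) (g' t) t :=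
    fun t _ => (hasDerivAt_birnbaum t).mul (hasDerivAt_gaussWeight t)
  have hneg : ∀ t ∈ Ioi x, g' t ≤ 0 := by
    intro t ht
    have ht0 : 0 ≤ t := hx.trans (le_of_lt ht)
    have h1 := birnbaum_pos t
    have h2 := gaussWeight_pos t
    have h3 : 0 ≤ birnbaum t / √(t ^ 2 + 4) * gaussWeight t := by positivity
    have h4 : 0 ≤ birnbaum t * (t * gaussWeight t) := by positivity
    simp only [g', neg_div]
    linarith
  have hlim : Tendsto (fun t => birnbaum t * gaussWeight t) atTop (𝓝 0) := by
    refine squeeze_zero' ?_ ?_ tendsto_gaussWeight_atTop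
    · filter_upwards [eventually_ge_atTop 0] with t ht
      exact mul_nonneg (birnbaum_pos t).le (gaussWeight_pos t).le
    · filter_upwards [eventually_ge_atTop 0] with t ht
      exact mul_le_of_le_one_left (gaussWeight_pos t).le (birnbaum_le_one ht)
  have hint := integrableOn_Ioi_deriv_of_nonpos' hd hneg hlim
  have heq := integral_Ioi_of_hasDerivAt_of_nonpos' hd hneg hlim
  have hle : ∫ t in Ioi x, -g' t ≤ ∫ t in Ioi x, gaussWeight t := by
    refine setIntegral_mono_on hint.neg integrable_gaussWeight.integrableOn measurableSet_Ioi ?_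
    intro t ht
    have ht0 : 0 ≤ t := hx.trans (le_of_lt ht)
    have h1 := birnbaum_pos t
    have h2 := gaussWeight_pos t
    have hs : 0 < √(t ^ 2 + 4) := Real.sqrt_pos.2 (by positivity)
    have h3 : birnbaum t / √(t ^ 2 + 4) ≤ birnbaum t ^ 2 := by
      rw [div_le_iff₀ hs]
      have : 1 ≤ birnbaum t * √(t ^ 2 + 4) := by
        have hs2 : √(t ^ 2 + 4) = 2 * birnbaum t + t := by unfold birnbaum; ring
        rw [hs2]
        nlinarith [birnbaum_eq t]
      nlinarith
    have h4 : birnbaum t / √(t ^ 2 + 4) + t * birnbaum t ≤ 1 := by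
      linarith [birnbaum_eq t]
    have h5 := mul_le_mul_of_nonneg_right h4 h2.le
    simp only [g', neg_div]
    linarith
  rw [integral_neg, heq] at hle
  linarith

/-- The bounded solution of the Stein equation `f' - x f = k`, for centered `k`. -/
def steinSol (k : ℝ → ℝ) (x : ℝ) : ℝ :=
  (gaussWeight x)⁻¹ * ∫ t in Iic x, k t * gaussWeight t

/-- The derivative of `steinSol k`, read off from the Stein equation. -/
def steinSolDeriv (k : ℝ → ℝ) (x : ℝ) : ℝ := x * steinSol k x + k x

lemma hasDerivAt_steinSol {k : ℝ → ℝ} (hk : Continuous k)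
    (hi : Integrable fun t => k t * gaussWeight t) (x : ℝ) :
    HasDerivAt (steinSol k) (steinSolDeriv k x) x := by
  have hI : HasDerivAt (fun y => ∫ t in Iic y, k t * gaussWeight t) (k x * gaussWeight x) x := by
    have h1 : HasDerivAt (fun y => (∫ t in Iic x, k t * gaussWeight t)
        + ∫ t in x..y, k t * gaussWeight t) (k x * gaussWeight x) x :=
      (intervalIntegral.integral_hasDerivAt_right (by simp)
        ((hk.mul continuous_gaussWeight).stronglyMeasurableAtFilter _ _)
        (hk.mul continuous_gaussWeight).continuousAt).const_add _
    refine h1.congr_of_eventuallyEq (Eventually.of_forall fun y => ?_)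
    have := intervalIntegral.integral_Iic_sub_Iic (a := x) (b := y) hi.integrableOn hi.integrableOn
    simp only
    linarith
  have hne := (gaussWeight_pos x).ne'
  refine (((hasDerivAt_gaussWeight x).inv hne).mul hI).congr_deriv ?_
  unfold steinSolDeriv steinSol
  simp only [Pi.inv_apply]
  field_simp

lemma continuous_steinSolDeriv {k : ℝ → ℝ} (hk : Continuous k)
    (hi : Integrable fun t => k t * gaussWeight t) : Continuous (steinSolDeriv k) :=
  (continuous_id.mul (continuous_iff_continuousAt.2 fun x =>
    (hasDerivAt_steinSol hk hi x).continuousAt)).add hk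

lemma steinSol_eq_neg {k : ℝ → ℝ} (hi : Integrable fun t => k t * gaussWeight t)
    (h0 : ∫ t, k t * gaussWeight t = 0) (x : ℝ) :
    steinSol k x = -((gaussWeight x)⁻¹ * ∫ t in Ioi x, k t * gaussWeight t) := by
  have h := intervalIntegral.integral_Iic_add_Ioi (b := x) hi.integrableOn hi.integrableOn
  rw [h0] at h
  rw [steinSol, eq_neg_of_add_eq_zero_left h]
  ring

lemma steinSolDeriv_neg {k : ℝ → ℝ} (hi : Integrable fun t => k t * gaussWeight t)
    (h0 : ∫ t, k t * gaussWeight t = 0) (x : ℝ) :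
    steinSolDeriv k (-x) = steinSolDeriv (fun t => k (-t)) x := by
  have h1 : steinSol (fun t => k (-t)) x = -steinSol k (-x) := by
    rw [steinSol_eq_neg hi h0, neg_neg, gaussWeight_neg, steinSol]
    have := integral_comp_neg_Iic x (fun t => k t * gaussWeight t)
    simp only [gaussWeight_neg] at this
    rw [this]
  simp only [steinSolDeriv, h1]
  ring

/-- Bounds on the derivative of the Stein solution may be checked on `[0, ∞)`, for families of
functions that are invariant under reflection. -/
lemma abs_steinSolDeriv_le_of_nonneg {p : (ℝ → ℝ) → Prop} {C : ℝ}
    (hp : ∀ k, p k → p fun t => k (-t))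
    (hpi : ∀ k, p k → Integrable fun t => k t * gaussWeight t)
    (h : ∀ k, p k → ∫ t, k t * gaussWeight t = 0 → ∀ x, 0 ≤ x → |steinSolDeriv k x| ≤ C)
    {k : ℝ → ℝ} (hk : p k) (h0 : ∫ t, k t * gaussWeight t = 0) (x : ℝ) :
    |steinSolDeriv k x| ≤ C := by
  rcases le_total 0 x with hx | hx
  · exact h k hk h0 x hx
  · rw [← neg_neg x, steinSolDeriv_neg (hpi k hk) h0]
    refine h _ (hp k hk) ?_ _ (by linarith)
    have := integral_neg_eq_self (fun t => k t * gaussWeight t) volume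
    simp only [gaussWeight_neg] at this
    rw [this, h0]

lemma abs_steinSolDeriv_le_two {k : ℝ → ℝ} (hkc : Continuous k) (hk : ∀ t, |k t| ≤ 1)
    (h0 : ∫ t, k t * gaussWeight t = 0) (x : ℝ) : |steinSolDeriv k x| ≤ 2 := by
  have hint : ∀ k : ℝ → ℝ, (Continuous k ∧ ∀ t, |k t| ≤ 1) →
      Integrable fun t => k t * gaussWeight t := fun k hk =>
    integrable_gaussWeight.bdd_mul hk.1.aestronglyMeasurable (ae_of_all _ hk.2)
  refine abs_steinSolDeriv_le_of_nonneg (p := fun k => Continuous k ∧ ∀ t, |k t| ≤ 1)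
    (fun k hk => ⟨hk.1.comp continuous_neg, fun t => hk.2 _⟩) hint ?_ ⟨hkc, hk⟩ h0 x
  intro k hk h0 x hx
  have hE := gaussWeight_pos x
  have h1 : |∫ t in Ioi x, k t * gaussWeight t| ≤ ∫ t in Ioi x, gaussWeight t := by
    refine abs_integral_le_integral_abs.trans (setIntegral_mono_on (hint k hk).abs.integrableOn
      integrable_gaussWeight.integrableOn measurableSet_Ioi fun t _ => ?_)
    rw [abs_mul, abs_of_pos (gaussWeight_pos t)]
    exact mul_le_of_le_one_left (gaussWeight_pos t).le (hk.2 t)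
  have h2 : x * ∫ t in Ioi x, gaussWeight t ≤ gaussWeight x := by
    linarith [integral_Ioi_sub_mul_gaussWeight x, integral_Ioi_sub_mul_gaussWeight_nonneg x]
  have h3 : |x * steinSol k x| ≤ 1 := by
    rw [steinSol_eq_neg (hint k hk) h0, abs_mul, abs_neg, abs_mul, abs_inv, abs_of_pos hE,
      abs_of_nonneg hx, ← mul_assoc, mul_comm x, mul_assoc, inv_mul_le_iff₀ hE, mul_one]
    exact (mul_le_mul_of_nonneg_left h1 hx).trans h2
  calc |steinSolDeriv k x| ≤ |x * steinSol k x| + |k x| := abs_add_le _ _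
    _ ≤ 2 := by linarith [hk.2 x]

lemma integrable_lipschitz_mul_gaussWeight {k : ℝ → ℝ} (hk : LipschitzWith 1 k) :
    Integrable fun t => k t * gaussWeight t := by
  refine Integrable.mono' ((integrable_gaussWeight.const_mul |k 0|).add
    integrable_mul_gaussWeight.abs)
    (hk.continuous.mul continuous_gaussWeight).aestronglyMeasurable (ae_of_all _ fun t => ?_)
  have h := hk.dist_le_mul t 0
  simp only [Real.dist_eq, sub_zero, NNReal.coe_one, one_mul] at h
  have h2 := abs_sub_abs_le_abs_sub (k t) (k 0)
  simp only [Real.norm_eq_abs, Pi.add_apply, abs_mul, abs_of_pos (gaussWeight_pos t), ← add_mul]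
  exact mul_le_mul_of_nonneg_right (by linarith) (gaussWeight_pos t).le

lemma integral_abs_sub_mul_gaussWeight (x : ℝ) :
    ∫ t, |t - x| * gaussWeight t
      = x * (∫ t, gaussWeight t) + 2 * ∫ t in Ioi x, (t - x) * gaussWeight t := by
  have hi : Integrable fun t => (t - x) * gaussWeight t := by
    simp only [sub_mul]
    exact integrable_mul_gaussWeight.sub (integrable_gaussWeight.const_mul x)
  have h1 : ∀ t, |t - x| * gaussWeight t
      = 2 * (Ioi x).indicator (fun t => (t - x) * gaussWeight t) t
      - (t - x) * gaussWeight t := by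
    intro t
    by_cases ht : x < t
    · rw [indicator_of_mem (by exact ht), abs_of_pos (by linarith)]
      ring
    · rw [indicator_of_notMem (by exact ht), abs_of_nonpos (by linarith)]
      ring
  simp only [h1]
  rw [integral_sub ((hi.indicator measurableSet_Ioi).const_mul 2) hi,
    integral_const_mul, integral_indicator measurableSet_Ioi, add_comm, sub_eq_add_neg]
  congr 1
  simp only [sub_mul]
  rw [integral_sub integrable_mul_gaussWeight (integrable_gaussWeight.const_mul x),
    integral_mul_gaussWeight, integral_const_mul]
  ring

lemma abs_steinSolDeriv_le_one {k : ℝ → ℝ} (hk : LipschitzWith 1 k)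
    (h0 : ∫ t, k t * gaussWeight t = 0) (x : ℝ) : |steinSolDeriv k x| ≤ 1 := by
  refine abs_steinSolDeriv_le_of_nonneg (p := LipschitzWith 1)
    (fun k hk => ?_) (fun k hk => integrable_lipschitz_mul_gaussWeight hk) ?_ hk h0 x
  · have := hk.comp (LipschitzWith.id (α := ℝ)).neg
    rwa [mul_one] at this
  intro k hk h0 x hx
  have hE := gaussWeight_pos x
  have hkint := integrable_lipschitz_mul_gaussWeight hk
  have hL : ∀ t, |k t - k x| ≤ |t - x| := fun t => by
    simpa [Real.dist_eq] using hk.dist_le_mul t x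
  set T := ∫ t in Ioi x, gaussWeight t with hT
  set d := 1 - x * ((gaussWeight x)⁻¹ * T) with hd
  have hdE : gaussWeight x - x * T = gaussWeight x * d := by
    rw [hd]; field_simp
  have hd0 : 0 ≤ d := by
    have := integral_Ioi_sub_mul_gaussWeight_nonneg x
    rw [integral_Ioi_sub_mul_gaussWeight, hdE] at this
    exact nonneg_of_mul_nonneg_right this hE
  have hlint : Integrable fun t => (k t - k x) * gaussWeight t := by
    simp only [sub_mul]
    exact hkint.sub (integrable_gaussWeight.const_mul _)
  have habs : Integrable fun t => |t - x| * gaussWeight t := by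
    refine integrable_lipschitz_mul_gaussWeight ?_
    refine LipschitzWith.of_dist_le_mul fun s t => ?_
    simpa [Real.dist_eq] using abs_abs_sub_abs_le_abs_sub (s - x) (t - x)
  have hl : ∀ t, |(k t - k x) * gaussWeight t| ≤ |t - x| * gaussWeight t := fun t => by
    rw [abs_mul, abs_of_pos (gaussWeight_pos t)]
    exact mul_le_mul_of_nonneg_right (hL t) (gaussWeight_pos t).le
  have h1 : |∫ t in Ioi x, (k t - k x) * gaussWeight t| ≤ gaussWeight x * d := by
    rw [← hdE, ← integral_Ioi_sub_mul_gaussWeight]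
    refine abs_integral_le_integral_abs.trans (setIntegral_mono_on hlint.abs.integrableOn
      ?_ measurableSet_Ioi fun t ht => ?_)
    · refine habs.integrableOn.congr_fun (fun t ht => ?_) measurableSet_Ioi
      simp only [abs_of_pos (sub_pos.2 (mem_Ioi.1 ht))]
    · refine (hl t).trans (le_of_eq ?_)
      rw [abs_of_pos (sub_pos.2 ht)]
  have h2 : |k x| ≤ x + d := by
    have h3 : ∫ t, (k t - k x) * gaussWeight t = -(k x * ∫ t, gaussWeight t) := by
      simp only [sub_mul]
      rw [integral_sub hkint (integrable_gaussWeight.const_mul _), h0, integral_const_mul]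
      ring
    have h4 : |k x * ∫ t, gaussWeight t| ≤ ∫ t, |t - x| * gaussWeight t := by
      rw [← abs_neg, ← h3]
      exact abs_integral_le_integral_abs.trans (integral_mono hlint.abs habs hl)
    rw [integral_abs_sub_mul_gaussWeight, integral_Ioi_sub_mul_gaussWeight, hdE, abs_mul] at h4
    have h5 := two_le_integral_gaussWeight
    rw [abs_of_nonneg (by linarith : 0 ≤ ∫ t, gaussWeight t)] at h4
    have h6 : 2 * (gaussWeight x * d) ≤ d * ∫ t, gaussWeight t := by
      nlinarith [mul_le_mul_of_nonneg_right (gaussWeight_le_one x) hd0]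
    by_contra! h7
    nlinarith
  have h3 : steinSolDeriv k x
      = k x * d - x * ((gaussWeight x)⁻¹ * ∫ t in Ioi x, (k t - k x) * gaussWeight t) := by
    simp only [sub_mul]
    rw [integral_sub hkint.integrableOn (integrable_gaussWeight.const_mul _).integrableOn,
      integral_const_mul, steinSolDeriv, steinSol_eq_neg hkint h0, hd]
    ring
  have h4 : |(gaussWeight x)⁻¹ * ∫ t in Ioi x, (k t - k x) * gaussWeight t| ≤ d := by
    rw [abs_mul, abs_inv, abs_of_pos hE, inv_mul_le_iff₀ hE]
    exact h1
  have h5 : |steinSolDeriv k x| ≤ (x + d) * d + x * d := by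
    rw [h3]
    refine (abs_sub _ _).trans (add_le_add ?_ ?_)
    · rw [abs_mul, abs_of_nonneg hd0]
      exact mul_le_mul_of_nonneg_right h2 hd0
    · rw [abs_mul, abs_of_nonneg hx]
      exact mul_le_mul_of_nonneg_left h4 hx
  set w := birnbaum x with hw
  have hw0 : 0 < w := birnbaum_pos x
  have hw1 : w ≤ 1 := birnbaum_le_one hx
  have hwx : w ^ 2 = 1 - x * w := birnbaum_eq x
  have hdw : d ≤ w ^ 2 := by
    rw [hwx, hd]
    have h6 : w ≤ (gaussWeight x)⁻¹ * T := by
      rw [le_inv_mul_iff₀ hE, mul_comm]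
      exact birnbaum_mul_gaussWeight_le hx
    nlinarith
  have h6 : (x + d) * d + x * d ≤ (x + w ^ 2) * w ^ 2 + x * w ^ 2 := by gcongr
  have h7 : (x + w ^ 2) * w ^ 2 + x * w ^ 2 = 1 - (1 - w) ^ 3 * (1 + w) := by
    have : x * w ^ 2 = (1 - w ^ 2) * w := by linear_combination w * hwx
    nlinarith
  have h8 : 0 ≤ (1 - w) ^ 3 * (1 + w) := by
    have : 0 ≤ 1 - w := by linarith
    positivity
  linarith

end

noncomputable section

open Set Filter Topology

/-- `H` is a Stein kernel for `Q`: `E[Q f(Q)] = E[H f'(Q)]` for `C¹` functions `f` with bounded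
derivative. -/
def IsSteinKernelOf {Ω : Type*} [MeasurableSpace Ω] (P : Measure Ω) (Q H : Ω → ℝ) : Prop :=
  ∀ (f f' : ℝ → ℝ) (C : ℝ), (∀ x, HasDerivAt f (f' x) x) → Continuous f' → (∀ x, |f' x| ≤ C) →
    ∫ ω, Q ω * f (Q ω) ∂P = ∫ ω, H ω * f' (Q ω) ∂P

lemma abs_integral_sub_gaussian_le {Ω : Type*} [MeasurableSpace Ω] {P : Measure Ω}
    [IsProbabilityMeasure P] {Q H : Ω → ℝ} (hQm : Measurable Q)
    (hH : Integrable H P) (hIBP : IsSteinKernelOf P Q H)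
    {h : ℝ → ℝ} (hh : Continuous h) (hhQ : Integrable (fun ω => h (Q ω)) P)
    (hhE : Integrable fun t => h t * gaussWeight t) {C : ℝ}
    (hC : ∀ x, |steinSolDeriv (fun t => h t - ∫ y, h y ∂(gaussianReal 0 1)) x| ≤ C) :
    |∫ x, h x ∂(P.map Q) - ∫ x, h x ∂(gaussianReal 0 1)| ≤ C * ∫ ω, |1 - H ω| ∂P := by
  set m := ∫ y, h y ∂(gaussianReal 0 1) with hm
  set k : ℝ → ℝ := fun t => h t - m with hk
  have hkc : Continuous k := hh.sub continuous_const
  have hki : Integrable fun t => k t * gaussWeight t := by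
    simp only [hk, sub_mul]
    exact hhE.sub (integrable_gaussWeight.const_mul m)
  have hder := hasDerivAt_steinSol hkc hki
  have hcont := continuous_steinSolDeriv hkc hki
  have hDQ : Integrable (fun ω => steinSolDeriv k (Q ω)) P :=
    Integrable.of_bound (hcont.measurable.comp hQm).aestronglyMeasurable C
      (ae_of_all _ fun ω => hC _)
  have hQf : Integrable (fun ω => Q ω * steinSol k (Q ω)) P := by
    have : Integrable (fun ω => steinSolDeriv k (Q ω) - k (Q ω)) P :=
      hDQ.sub (hhQ.sub (integrable_const m))
    refine this.congr (ae_of_all _ fun ω => ?_)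
    simp [steinSolDeriv]
  have hHf : Integrable (fun ω => H ω * steinSolDeriv k (Q ω)) P :=
    hH.mul_bdd hDQ.aestronglyMeasurable (ae_of_all _ fun ω => hC _)
  have hmain : ∫ x, h x ∂(P.map Q) - m = ∫ ω, (1 - H ω) * steinSolDeriv k (Q ω) ∂P := by
    rw [integral_map hQm.aemeasurable hh.aestronglyMeasurable]
    have h1 : ∫ ω, k (Q ω) ∂P = ∫ ω, h (Q ω) ∂P - m := by
      simp only [hk]
      rw [integral_sub hhQ (integrable_const m)]
      simp
    have h2 : ∫ ω, k (Q ω) ∂P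
        = ∫ ω, steinSolDeriv k (Q ω) ∂P - ∫ ω, Q ω * steinSol k (Q ω) ∂P := by
      rw [← integral_sub hDQ hQf]
      refine integral_congr_ae (ae_of_all _ fun ω => ?_)
      simp [steinSolDeriv]
    simp only [sub_mul, one_mul]
    rw [integral_sub hDQ hHf, ← hIBP _ _ C hder hcont hC, ← h1, h2]
  rw [hmain, ← integral_const_mul]
  refine abs_integral_le_integral_abs.trans (integral_mono_of_nonneg (ae_of_all _ fun ω =>
    abs_nonneg _) (((integrable_const 1).sub hH).abs.const_mul C) (ae_of_all _ fun ω => ?_))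
  simp only [abs_mul]
  rw [mul_comm]
  exact mul_le_mul_of_nonneg_right (hC _) (abs_nonneg _)

lemma integral_centered_mul_gaussWeight {h : ℝ → ℝ}
    (hhE : Integrable fun t => h t * gaussWeight t) :
    ∫ t, (h t - ∫ y, h y ∂(gaussianReal 0 1)) * gaussWeight t = 0 := by
  simp only [sub_mul]
  rw [integral_sub hhE (integrable_gaussWeight.const_mul _), integral_const_mul,
    integral_gaussianReal_eq]
  have := two_le_integral_gaussWeight
  field_simp
  ring

theorem wassersteinDist_gaussian_le {Ω : Type*} [MeasurableSpace Ω] {P : Measure Ω}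
    [IsProbabilityMeasure P] {Q H : Ω → ℝ} (hQm : Measurable Q)
    (hQ2 : Integrable (fun ω => Q ω ^ 2) P) (hH : Integrable H P)
    (hIBP : IsSteinKernelOf P Q H) :
    wassersteinDist (P.map Q) (gaussianReal 0 1) ≤ ENNReal.ofReal (∫ ω, |1 - H ω| ∂P) := by
  refine iSup₂_le fun h hh => ENNReal.ofReal_le_ofReal ?_
  have hQ1 : Integrable Q P :=
    ((memLp_two_iff_integrable_sq hQm.aestronglyMeasurable).2 hQ2).integrable one_le_two
  have hhE := integrable_lipschitz_mul_gaussWeight hh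
  have hhQ : Integrable (fun ω => h (Q ω)) P := by
    refine Integrable.mono' ((integrable_const |h 0|).add hQ1.abs)
      (hh.continuous.measurable.comp hQm).aestronglyMeasurable (ae_of_all _ fun ω => ?_)
    have h1 := hh.dist_le_mul (Q ω) 0
    simp only [Real.dist_eq, sub_zero, NNReal.coe_one, one_mul] at h1
    have h2 := abs_sub_abs_le_abs_sub (h (Q ω)) (h 0)
    simp only [Real.norm_eq_abs, Pi.add_apply]
    linarith
  have := abs_integral_sub_gaussian_le hQm hH hIBP hh.continuous hhQ hhE (C := 1)
    (abs_steinSolDeriv_le_one (LipschitzWith.of_dist_le_mul fun s t => by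
      simpa [Real.dist_eq] using hh.dist_le_mul s t) (integral_centered_mul_gaussWeight hhE))
  linarith

/-- Indicators are approximated in `L¹` by continuous functions with values in `[0, 1]`. -/
lemma exists_continuous_indicator_approx (μ : Measure ℝ) [IsFiniteMeasure μ] {A : Set ℝ}
    (hA : MeasurableSet A) {ε : ℝ} (hε : 0 < ε) :
    ∃ h : ℝ → ℝ, Continuous h ∧ (∀ x, h x ∈ Icc (0 : ℝ) 1) ∧
      ∫ x, |A.indicator 1 x - h x| ∂μ ≤ ε := by
  have hi : Integrable (A.indicator (1 : ℝ → ℝ)) μ := (integrable_const 1).indicator hA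
  obtain ⟨g, hg, hgi⟩ := hi.exists_boundedContinuous_integral_sub_le hε
  refine ⟨fun x => max 0 (min 1 (g x)), by fun_prop,
    fun x => ⟨le_max_left _ _, max_le zero_le_one (min_le_left _ _)⟩, le_trans ?_ hg⟩
  refine integral_mono_of_nonneg (ae_of_all _ fun x => abs_nonneg _) (hi.sub hgi).norm
    (ae_of_all _ fun x => ?_)
  simp only [Real.norm_eq_abs]
  by_cases hx : x ∈ A
  · simp only [indicator_of_mem hx, Pi.one_apply]
    rcases le_total (g x) 1 with h1 | h1 <;> rcases le_total 0 (g x) with h0 | h0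
    · rw [min_eq_right h1, max_eq_right h0]
    · rw [min_eq_right h1, max_eq_left h0]
      rw [abs_of_nonneg (by norm_num), abs_of_nonneg (by linarith)]
      linarith
    · simp [min_eq_left h1]
    · linarith
  · simp only [indicator_of_notMem hx, zero_sub, abs_neg]
    rcases le_total (g x) 1 with h1 | h1 <;> rcases le_total 0 (g x) with h0 | h0
    · rw [min_eq_right h1, max_eq_right h0]
    · simp [min_eq_right h1, max_eq_left h0]
    · simp [abs_of_nonneg h0, h1]
    · linarith

theorem totalVariationDist_gaussian_le {Ω : Type*} [MeasurableSpace Ω] {P : Measure Ω}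
    [IsProbabilityMeasure P] {Q H : Ω → ℝ} (hQm : Measurable Q)
    (hH : Integrable H P)
    (hIBP : IsSteinKernelOf P Q H) :
    totalVariationDist (P.map Q) (gaussianReal 0 1) ≤ ENNReal.ofReal (2 * ∫ ω, |1 - H ω| ∂P) := by
  refine iSup₂_le fun A hA => ENNReal.ofReal_le_ofReal ?_
  refine le_of_forall_pos_le_add fun ε hε => ?_
  have hPQ : IsProbabilityMeasure (P.map Q) := Measure.isProbabilityMeasure_map hQm.aemeasurable
  obtain ⟨h, hc, h01, hint⟩ :=
    exists_continuous_indicator_approx (P.map Q + gaussianReal 0 1) hA hε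
  have hb : ∀ x, |h x| ≤ 1 := fun x => abs_le.2 ⟨by linarith [(h01 x).1], (h01 x).2⟩
  have hbi : ∀ (ν : Measure ℝ) [IsFiniteMeasure ν], Integrable h ν := fun ν _ =>
    Integrable.of_bound hc.aestronglyMeasurable 1 (ae_of_all _ hb)
  have hAi : ∀ (ν : Measure ℝ) [IsFiniteMeasure ν], Integrable (A.indicator (1 : ℝ → ℝ)) ν :=
    fun ν _ => (integrable_const 1).indicator hA
  have hsub : ∀ (ν : Measure ℝ) [IsFiniteMeasure ν],
      |ν.real A - ∫ x, h x ∂ν| ≤ ∫ x, |A.indicator 1 x - h x| ∂ν := by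
    intro ν _
    rw [← integral_indicator_one hA, ← integral_sub (hAi ν) (hbi ν)]
    exact abs_integral_le_integral_abs
  have hdi : ∀ (ν : Measure ℝ) [IsFiniteMeasure ν],
      Integrable (fun x => |A.indicator 1 x - h x|) ν := fun ν _ => ((hAi ν).sub (hbi ν)).abs
  rw [integral_add_measure (hdi _) (hdi _)] at hint
  have hhE : Integrable fun t => h t * gaussWeight t :=
    integrable_gaussWeight.bdd_mul hc.aestronglyMeasurable (ae_of_all _ hb)
  have hm : (∫ y, h y ∂(gaussianReal 0 1)) ∈ Icc (0 : ℝ) 1 := by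
    refine ⟨integral_nonneg fun x => (h01 x).1, ?_⟩
    have := integral_mono (hbi (gaussianReal 0 1)) (integrable_const 1) fun x => (h01 x).2
    simpa using this
  have hkey := abs_integral_sub_gaussian_le hQm hH hIBP hc
    ((hbi (P.map Q)).comp_measurable hQm) hhE (C := 2)
    (abs_steinSolDeriv_le_two (hc.sub continuous_const) (fun t => abs_le.2
      ⟨by linarith [(h01 t).1, hm.2], by linarith [(h01 t).2, hm.1]⟩)
      (integral_centered_mul_gaussWeight hhE))
  have h1 := hsub (P.map Q)
  have h2 := hsub (gaussianReal 0 1)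
  rw [abs_le] at h1 h2 hkey ⊢
  constructor <;> linarith [h1.1, h1.2, h2.1, h2.2, hkey.1, hkey.2]

end

noncomputable section

open Function Finset

variable {ι : Type*} [Fintype ι]

lemma integrable_comp_eval {μ : Measure ℝ} [IsProbabilityMeasure μ] (i : ι) {g : ℝ → ℝ}
    (hg : Integrable g μ) : Integrable (fun x : ι → ℝ => g (x i)) (Measure.pi fun _ : ι => μ) :=
  (measurePreserving_eval (fun _ : ι => μ) i).integrable_comp_of_integrable hg

lemma integral_comp_eval {μ : Measure ℝ} [IsProbabilityMeasure μ] (i : ι) {g : ℝ → ℝ}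
    (hg : AEStronglyMeasurable g μ) :
    ∫ x : ι → ℝ, g (x i) ∂(Measure.pi fun _ : ι => μ) = ∫ z, g z ∂μ := by
  have hmp := measurePreserving_eval (fun _ : ι => μ) i
  conv_rhs => rw [← hmp.map_eq]
  rw [integral_map hmp.measurable.aemeasurable (by rwa [hmp.map_eq])]

/-- Resampling one coordinate preserves a product of probability measures. -/
lemma measurePreserving_update [DecidableEq ι] (μ : Measure ℝ) [IsProbabilityMeasure μ] (i : ι) :
    MeasurePreserving (fun p : (ι → ℝ) × ℝ => update p.1 i p.2)
      ((Measure.pi fun _ : ι => μ).prod μ) (Measure.pi fun _ : ι => μ) := by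
  refine ⟨measurable_update', (Measure.pi_eq fun s hs => ?_).symm⟩
  rw [Measure.map_apply measurable_update' (MeasurableSet.univ_pi hs)]
  have h : (fun p : (ι → ℝ) × ℝ => update p.1 i p.2) ⁻¹' Set.univ.pi s
      = (Set.univ.pi (update s i Set.univ)) ×ˢ s i := by
    ext p
    simp only [Set.mem_preimage, Set.mem_pi, Set.mem_univ, true_implies, Set.mem_prod]
    constructor
    · refine fun h => ⟨fun j => ?_, by simpa using h i⟩
      by_cases hj : j = i
      · subst hj; simp
      · simpa [hj] using h j
    · rintro ⟨h1, h2⟩ j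
      by_cases hj : j = i
      · subst hj; simpa using h2
      · simpa [hj] using h1 j
  rw [h, Measure.prod_prod, Measure.pi_pi, ← mul_prod_erase univ _ (mem_univ i),
    ← mul_prod_erase univ (fun j => μ (s j)) (mem_univ i)]
  simp only [update_self, measure_univ, one_mul]
  rw [mul_comm]
  congr 1
  exact prod_congr rfl fun j hj => by rw [update_of_ne (ne_of_mem_erase hj)]

lemma integral_mul_of_update_invariant [DecidableEq ι] {μ : Measure ℝ}
    [IsProbabilityMeasure μ] {i : ι}
    {g : ℝ → ℝ} {G : (ι → ℝ) → ℝ} (hg : Measurable g) (hG : Measurable G)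
    (hinv : ∀ x z, G (update x i z) = G x) :
    ∫ x, g (x i) * G x ∂(Measure.pi fun _ : ι => μ)
      = (∫ z, g z ∂μ) * ∫ x, G x ∂(Measure.pi fun _ : ι => μ) := by
  have hmp := measurePreserving_update μ i
  conv_lhs => rw [← hmp.map_eq]
  have hm : Measurable fun x : ι → ℝ => g (x i) * G x := (hg.comp (measurable_pi_apply i)).mul hG
  rw [integral_map hmp.measurable.aemeasurable hm.aestronglyMeasurable]
  simp only [update_self, hinv]
  rw [mul_comm, ← integral_prod_mul]
  simp only [mul_comm]

lemma integrable_mul_of_update_invariant [DecidableEq ι] {μ : Measure ℝ}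
    [IsProbabilityMeasure μ] {i : ι}
    {g : ℝ → ℝ} {G : (ι → ℝ) → ℝ} (hgm : Measurable g) (hGm : Measurable G)
    (hg : Integrable g μ) (hG : Integrable G (Measure.pi fun _ : ι => μ))
    (hinv : ∀ x z, G (update x i z) = G x) :
    Integrable (fun x => g (x i) * G x) (Measure.pi fun _ : ι => μ) := by
  have hmp := measurePreserving_update μ i
  have hm : Measurable fun x : ι → ℝ => g (x i) * G x :=
    (hgm.comp (measurable_pi_apply i)).mul hGm
  rw [← hmp.map_eq, integrable_map_measure hm.aestronglyMeasurable hmp.measurable.aemeasurable]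
  refine (hG.mul_prod hg).congr (ae_of_all _ fun p => ?_)
  simp only [comp_apply, update_self, hinv, mul_comm]

lemma integrable_comp_update [DecidableEq ι] {μ : Measure ℝ} [IsProbabilityMeasure μ] (i : ι)
    {F : (ι → ℝ) → ℝ} (hF : Integrable F (Measure.pi fun _ : ι => μ)) :
    Integrable (fun p : (ι → ℝ) × ℝ => F (update p.1 i p.2))
      ((Measure.pi fun _ : ι => μ).prod μ) :=
  (measurePreserving_update μ i).integrable_comp_of_integrable hF

lemma integral_eq_integral_update [DecidableEq ι] {μ : Measure ℝ} [IsProbabilityMeasure μ] (i : ι)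
    {F : (ι → ℝ) → ℝ} (hF : Integrable F (Measure.pi fun _ : ι => μ)) :
    ∫ x, F x ∂(Measure.pi fun _ : ι => μ)
      = ∫ x, ∫ z, F (update x i z) ∂μ ∂(Measure.pi fun _ : ι => μ) := by
  have hmp := measurePreserving_update μ i
  rw [← integral_prod (fun p : (ι → ℝ) × ℝ => F (update p.1 i p.2)) (integrable_comp_update i hF)]
  conv_lhs => rw [← hmp.map_eq]
  exact integral_map hmp.measurable.aemeasurable (by rw [hmp.map_eq]; exact hF.aestronglyMeasurable)

/-- The law `μ` is standardized, with finite fourth moment. -/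
structure IsStandardized (μ : Measure ℝ) : Prop where
  integral_id : ∫ x, x ∂μ = 0
  integral_sq : ∫ x, x ^ 2 ∂μ = 1
  integrable_pow_four : Integrable (fun x => x ^ 4) μ

namespace IsStandardized

variable {μ : Measure ℝ} [IsProbabilityMeasure μ]

lemma integrable_pow_two (h : IsStandardized μ) : Integrable (fun x => x ^ 2) μ := by
  refine Integrable.mono' ((integrable_const 1).add h.integrable_pow_four)
    (by fun_prop) (ae_of_all _ fun x => ?_)
  simp only [Real.norm_eq_abs, abs_pow, sq_abs, Pi.add_apply]
  nlinarith [sq_nonneg (x ^ 2 - 1)]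

lemma one_le_integral_pow_four (h : IsStandardized μ) : 1 ≤ ∫ x, x ^ 4 ∂μ := by
  have h2 : Integrable (fun x => x ^ 4 - 2 * x ^ 2) μ :=
    h.integrable_pow_four.sub (h.integrable_pow_two.const_mul 2)
  have h1 : 0 ≤ ∫ x, (x ^ 4 - 2 * x ^ 2 + 1) ∂μ :=
    integral_nonneg fun x => by
      simp only [Pi.zero_apply]
      nlinarith [sq_nonneg (x ^ 2 - 1)]
  rw [integral_add h2 (integrable_const 1),
    integral_sub h.integrable_pow_four (h.integrable_pow_two.const_mul 2),
    integral_const_mul, h.integral_sq] at h1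
  simp at h1
  linarith

lemma integrable_mul_four (h : IsStandardized μ) (a b c d : ι) :
    Integrable (fun x : ι → ℝ => x a * x b * x c * x d) (Measure.pi fun _ : ι => μ) := by
  have h4 : ∀ i : ι, Integrable (fun x : ι → ℝ => x i ^ 4) (Measure.pi fun _ : ι => μ) :=
    fun i => integrable_comp_eval i h.integrable_pow_four
  refine Integrable.mono' (((h4 a).add (h4 b)).add ((h4 c).add (h4 d)))
    (Measurable.aestronglyMeasurable (by fun_prop)) (ae_of_all _ fun x => ?_)
  simp only [Real.norm_eq_abs, Pi.add_apply]
  rw [abs_le]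
  constructor <;>
    nlinarith [sq_nonneg (x a * x b - x c * x d), sq_nonneg (x a * x b + x c * x d),
      sq_nonneg (x a ^ 2 - x b ^ 2), sq_nonneg (x c ^ 2 - x d ^ 2), sq_nonneg (x a ^ 2),
      sq_nonneg (x b ^ 2), sq_nonneg (x c ^ 2), sq_nonneg (x d ^ 2)]

lemma integrable_mul_two (h : IsStandardized μ) (a b : ι) :
    Integrable (fun x : ι → ℝ => x a * x b) (Measure.pi fun _ : ι => μ) := by
  have h2 : ∀ i : ι, Integrable (fun x : ι → ℝ => x i ^ 2) (Measure.pi fun _ : ι => μ) :=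
    fun i => integrable_comp_eval i h.integrable_pow_two
  refine Integrable.mono' ((h2 a).add (h2 b))
    (Measurable.aestronglyMeasurable (by fun_prop)) (ae_of_all _ fun x => ?_)
  simp only [Real.norm_eq_abs, Pi.add_apply]
  rw [abs_le]
  constructor <;> nlinarith [sq_nonneg (x a - x b), sq_nonneg (x a + x b)]

lemma integrable_eval (h : IsStandardized μ) (a : ι) :
    Integrable (fun x : ι → ℝ => x a) (Measure.pi fun _ : ι => μ) :=
  integrable_comp_eval (g := fun x => x) a
    (((memLp_two_iff_integrable_sq measurable_id.aestronglyMeasurable).2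
      h.integrable_pow_two).integrable one_le_two)

lemma integral_eval (h : IsStandardized μ) (a : ι) :
    ∫ x : ι → ℝ, x a ∂(Measure.pi fun _ : ι => μ) = 0 := by
  rw [integral_comp_eval (g := fun x => x) a (by fun_prop), h.integral_id]

lemma integral_mul_of_ne [DecidableEq ι] (h : IsStandardized μ) {a : ι} {G : (ι → ℝ) → ℝ}
    (hG : Measurable G) (hinv : ∀ x z, G (update x a z) = G x) :
    ∫ x : ι → ℝ, x a * G x ∂(Measure.pi fun _ : ι => μ) = 0 := by
  rw [integral_mul_of_update_invariant (g := fun x => x) measurable_id hG hinv, h.integral_id,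
    zero_mul]

lemma integral_mul_two [DecidableEq ι] (h : IsStandardized μ) (a b : ι) :
    ∫ x : ι → ℝ, x a * x b ∂(Measure.pi fun _ : ι => μ) = if a = b then 1 else 0 := by
  split_ifs with hab
  · subst hab
    simp only [← sq]
    rw [integral_comp_eval (g := fun x => x ^ 2) a (by fun_prop), h.integral_sq]
  · exact h.integral_mul_of_ne (by fun_prop) fun x z => by rw [update_of_ne (Ne.symm hab)]

lemma integral_sq_mul_sq [DecidableEq ι] (h : IsStandardized μ) {a b : ι} (hab : a ≠ b) :
    ∫ x : ι → ℝ, x a ^ 2 * x b ^ 2 ∂(Measure.pi fun _ : ι => μ) = 1 := by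
  rw [integral_mul_of_update_invariant (g := fun x => x ^ 2) (G := fun x => x b ^ 2) (by fun_prop)
    (by fun_prop) (fun x z => by rw [update_of_ne hab.symm]), h.integral_sq,
    integral_comp_eval (g := fun x => x ^ 2) b (by fun_prop), h.integral_sq, one_mul]

lemma integral_mul_four_of_ne [DecidableEq ι] (h : IsStandardized μ) {a b c d : ι} (hb : a ≠ b)
    (hc : a ≠ c) (hd : a ≠ d) :
    ∫ x : ι → ℝ, x a * (x b * x c * x d) ∂(Measure.pi fun _ : ι => μ) = 0 :=
  h.integral_mul_of_ne (by fun_prop) fun x z => by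
    rw [update_of_ne hb.symm, update_of_ne hc.symm, update_of_ne hd.symm]

lemma integral_mul_four [DecidableEq ι] (h : IsStandardized μ) (a b c d : ι) :
    ∫ x : ι → ℝ, x a * x b * x c * x d ∂(Measure.pi fun _ : ι => μ)
      = (if a = b then if c = d then 1 else 0 else 0)
        + (if a = c then if b = d then 1 else 0 else 0)
        + (if a = d then if b = c then 1 else 0 else 0)
        + (if a = b then if a = c then if a = d then ((∫ x, x ^ 4 ∂μ) - 3) else 0 else 0
          else 0) := by
  have hne : ∀ a b c d : ι, a ≠ b → a ≠ c → a ≠ d → ∀ F : (ι → ℝ) → ℝ,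
      (∀ x, F x = x a * (x b * x c * x d)) → ∫ x, F x ∂(Measure.pi fun _ : ι => μ) = 0 := by
    intro a b c d hb hc hd F hF
    simp only [hF]
    exact h.integral_mul_four_of_ne hb hc hd
  have hpair : ∀ a b : ι, a ≠ b → ∀ F : (ι → ℝ) → ℝ,
      (∀ x, F x = x a ^ 2 * x b ^ 2) → ∫ x, F x ∂(Measure.pi fun _ : ι => μ) = 1 := by
    intro a b hb F hF
    simp only [hF]
    exact h.integral_sq_mul_sq hb
  by_cases hab : a = b
  · subst hab
    by_cases hcd : c = d
    · subst hcd
      by_cases hac : a = c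
      · subst hac
        have : ∀ x : ι → ℝ, x a * x a * x a * x a = x a ^ 4 := fun x => by ring
        simp only [this]
        rw [integral_comp_eval (g := fun x => x ^ 4) a (by fun_prop)]
        simp
        ring
      · rw [hpair a c hac _ fun x => by ring]
        simp [hac]
    · by_cases hac : a = c
      · subst hac
        rw [hne d a a a (Ne.symm hcd) (Ne.symm hcd) (Ne.symm hcd) _ fun x => by ring]
        simp [hcd]
      · rw [hne c a a d (Ne.symm hac) (Ne.symm hac) hcd _ fun x => by ring]
        simp [hac, hcd]
  · by_cases hac : a = c
    · subst hac
      by_cases hbd : b = d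
      · subst hbd
        rw [hpair a b hab _ fun x => by ring]
        simp [hab]
      · rw [hne b a a d (Ne.symm hab) (Ne.symm hab) hbd _ fun x => by ring]
        simp [hab, hbd, Ne.symm hab]
    · by_cases had : a = d
      · subst had
        by_cases hbc : b = c
        · subst hbc
          rw [hpair a b hab _ fun x => by ring]
          simp [hab]
        · rw [hne b a a c (Ne.symm hab) (Ne.symm hab) hbc _ fun x => by ring]
          simp [hab, hac, hbc]
      · rw [hne a b c d hab hac had _ fun x => by ring]
        simp [hab, hac, had]

/-- Second moment of a quadratic form in independent standardized variables. -/
lemma integral_quad_sq [DecidableEq ι] (h : IsStandardized μ) (c : ι → ι → ℝ)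
    (hc : ∀ k l, c k l = c l k) :
    ∫ x : ι → ℝ, (∑ k, ∑ l, c k l * x k * x l) ^ 2 ∂(Measure.pi fun _ : ι => μ)
      = (∑ k, c k k) ^ 2 + 2 * (∑ k, ∑ l, c k l ^ 2)
        + ((∫ x, x ^ 4 ∂μ) - 3) * ∑ k, c k k ^ 2 := by
  have hexp : ∀ x : ι → ℝ, (∑ k, ∑ l, c k l * x k * x l) ^ 2
      = ∑ p : (ι × ι) × (ι × ι), c p.1.1 p.1.2 * c p.2.1 p.2.2
        * (x p.1.1 * x p.1.2 * x p.2.1 * x p.2.2) := by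
    intro x
    have : ∑ k, ∑ l, c k l * x k * x l = ∑ p : ι × ι, c p.1 p.2 * x p.1 * x p.2 := by
      rw [Fintype.sum_prod_type]
    rw [this, sq, sum_mul_sum, Fintype.sum_prod_type (α₁ := ι × ι)]
    exact sum_congr rfl fun p _ => sum_congr rfl fun q _ => by ring
  simp only [hexp]
  rw [integral_finsetSum _ fun p _ => (h.integrable_mul_four _ _ _ _).const_mul _]
  simp only [integral_const_mul, h.integral_mul_four, Fintype.sum_prod_type, mul_add,
    sum_add_distrib, mul_ite, mul_one, mul_zero]
  have e1 : ∑ a, ∑ b, ∑ c', ∑ d, (if a = b then if c' = d then c a b * c c' d else 0 else 0)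
      = (∑ k, c k k) ^ 2 := by
    rw [sq, sum_mul_sum]
    refine sum_congr rfl fun a _ => ?_
    rw [sum_comm]
    refine sum_congr rfl fun c' _ => ?_
    rw [sum_comm, sum_eq_single c' (by intro d _ hd; simp [Ne.symm hd]) (by simp)]
    simp
  have e2 : ∑ a, ∑ b, ∑ c', ∑ d, (if a = c' then if b = d then c a b * c c' d else 0 else 0)
      = ∑ k, ∑ l, c k l ^ 2 := by
    refine sum_congr rfl fun a _ => sum_congr rfl fun b _ => ?_
    rw [sum_eq_single a (by intro d _ hd; simp [Ne.symm hd]) (by simp)]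
    simp [sq]
  have e3 : ∑ a, ∑ b, ∑ c', ∑ d, (if a = d then if b = c' then c a b * c c' d else 0 else 0)
      = ∑ k, ∑ l, c k l ^ 2 := by
    refine sum_congr rfl fun a _ => sum_congr rfl fun b _ => ?_
    rw [sum_comm, sum_eq_single a (by intro d _ hd; simp [Ne.symm hd]) (by simp)]
    simp [sq, hc b a]
  have e4 : ∑ a, ∑ b, ∑ c', ∑ d, (if a = b then if a = c' then if a = d then
      c a b * c c' d * ((∫ x, x ^ 4 ∂μ) - 3) else 0 else 0 else 0)
      = ((∫ x, x ^ 4 ∂μ) - 3) * ∑ k, c k k ^ 2 := by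
    rw [mul_sum]
    refine sum_congr rfl fun a _ => ?_
    rw [sum_eq_single a (by intro d _ hd; simp [Ne.symm hd]) (by simp),
      sum_eq_single a (by intro d _ hd; simp [Ne.symm hd]) (by simp)]
    simp
    ring
  rw [e1, e2, e3, e4]
  ring

lemma integral_quad [DecidableEq ι] (h : IsStandardized μ) (c : ι → ι → ℝ) :
    ∫ x : ι → ℝ, ∑ k, ∑ l, c k l * x k * x l ∂(Measure.pi fun _ : ι => μ) = ∑ k, c k k := by
  rw [integral_finsetSum _ fun k _ => integrable_finsetSum _ fun l _ => by
    simpa only [mul_assoc] using (h.integrable_mul_two k l).const_mul (c k l)]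
  refine sum_congr rfl fun k _ => ?_
  rw [integral_finsetSum _ fun l _ => by
    simpa only [mul_assoc] using (h.integrable_mul_two k l).const_mul (c k l)]
  simp only [mul_assoc, integral_const_mul, h.integral_mul_two]
  simp

lemma integrable_quad_sq (h : IsStandardized μ) (c : ι → ι → ℝ) :
    Integrable (fun x : ι → ℝ => (∑ k, ∑ l, c k l * x k * x l) ^ 2)
      (Measure.pi fun _ : ι => μ) := by
  simp only [sq, sum_mul_sum]
  refine integrable_finsetSum _ fun k _ => integrable_finsetSum _ fun l _ =>
    integrable_finsetSum _ fun i _ => integrable_finsetSum _ fun j _ => ?_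
  refine ((h.integrable_mul_four k i l j).const_mul (c k i * c l j)).congr
    (ae_of_all _ fun x => ?_)
  simp only
  ring

end IsStandardized

end

noncomputable section

open Function Finset

/-- The Cauchy-Schwarz inequality for integrals. -/
lemma integral_mul_sq_le {α : Type*} [MeasurableSpace α] {ν : Measure α} {f g : α → ℝ}
    (hf : Integrable (fun x => f x ^ 2) ν) (hg : Integrable (fun x => g x ^ 2) ν)
    (hfg : Integrable (fun x => f x * g x) ν) :
    (∫ x, f x * g x ∂ν) ^ 2 ≤ (∫ x, f x ^ 2 ∂ν) * ∫ x, g x ^ 2 ∂ν := by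
  have h : ∀ t : ℝ, 0 ≤ (∫ x, f x ^ 2 ∂ν) * (t * t) + 2 * (∫ x, f x * g x ∂ν) * t
      + ∫ x, g x ^ 2 ∂ν := by
    intro t
    have h1 : 0 ≤ ∫ x, (t * f x + g x) ^ 2 ∂ν := integral_nonneg fun x => sq_nonneg _
    have h2 : ∀ x, (t * f x + g x) ^ 2
        = (t * t) * f x ^ 2 + 2 * t * (f x * g x) + g x ^ 2 := fun x => by ring
    simp only [h2] at h1
    rw [integral_add ((hf.const_mul _).fun_add (hfg.const_mul _)) hg,
      integral_add (hf.const_mul _) (hfg.const_mul _), integral_const_mul, integral_const_mul] at h1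
    linarith
  have := discrim_le_zero h
  unfold discrim at this
  linarith

variable {ι : Type*} [Fintype ι]

/-- The linear form with coefficients `b`. -/
def linForm (b x : ι → ℝ) : ℝ := ∑ l, b l * x l

lemma measurable_linForm (b : ι → ℝ) : Measurable (linForm b) := by
  unfold linForm
  fun_prop

lemma linForm_update [DecidableEq ι] (b x : ι → ℝ) (i : ι) (z : ℝ) :
    linForm b (update x i z) = linForm b x + b i * (z - x i) := by
  rw [← sub_eq_iff_eq_add', linForm, linForm, ← sum_sub_distrib,
    sum_eq_single i (by intro l _ hl; rw [update_of_ne hl, sub_self]) (by simp)]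
  rw [update_self]
  ring

lemma linForm_update_of_eq_zero [DecidableEq ι] {b : ι → ℝ} {i : ι} (hb : b i = 0) (x : ι → ℝ)
    (z : ℝ) : linForm b (update x i z) = linForm b x := by
  rw [linForm_update, hb, zero_mul, add_zero]

lemma linForm_update_left [DecidableEq ι] (b x : ι → ℝ) (i : ι) :
    linForm (update b i 0) x = linForm b x - b i * x i := by
  rw [eq_comm, sub_eq_iff_eq_add', ← sub_eq_iff_eq_add, linForm, linForm, ← sum_sub_distrib,
    sum_eq_single i (by intro l _ hl; rw [update_of_ne hl, sub_self]) (by simp)]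
  rw [update_self]
  ring

lemma linForm_mul_linForm (b d x : ι → ℝ) :
    linForm b x * linForm d x = ∑ k, ∑ l, b k * d l * x k * x l := by
  rw [linForm, linForm, sum_mul_sum]
  exact sum_congr rfl fun k _ => sum_congr rfl fun l _ => by ring

namespace IsStandardized

variable {μ : Measure ℝ} [IsProbabilityMeasure μ]

lemma integrable_linForm (h : IsStandardized μ) (b : ι → ℝ) :
    Integrable (linForm b) (Measure.pi fun _ : ι => μ) := by
  unfold linForm
  exact integrable_finsetSum _ fun l _ => (h.integrable_eval l).const_mul _

lemma integral_linForm (h : IsStandardized μ) (b : ι → ℝ) :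
    ∫ x, linForm b x ∂(Measure.pi fun _ : ι => μ) = 0 := by
  unfold linForm
  rw [integral_finsetSum _ fun l _ => (h.integrable_eval l).const_mul _]
  simp only [integral_const_mul, h.integral_eval, mul_zero, sum_const_zero]

lemma integrable_linForm_mul (h : IsStandardized μ) (b d : ι → ℝ) :
    Integrable (fun x => linForm b x * linForm d x) (Measure.pi fun _ : ι => μ) := by
  simp only [linForm_mul_linForm]
  exact integrable_finsetSum _ fun k _ => integrable_finsetSum _ fun l _ => by
    simpa only [mul_assoc] using (h.integrable_mul_two k l).const_mul (b k * d l)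

lemma integral_linForm_mul [DecidableEq ι] (h : IsStandardized μ) (b d : ι → ℝ) :
    ∫ x, linForm b x * linForm d x ∂(Measure.pi fun _ : ι => μ) = ∑ l, b l * d l := by
  simp only [linForm_mul_linForm]
  rw [h.integral_quad fun k l => b k * d l]

lemma integrable_linForm_pow_four (h : IsStandardized μ) (b : ι → ℝ) :
    Integrable (fun x => (linForm b x ^ 2) ^ 2) (Measure.pi fun _ : ι => μ) := by
  simp only [sq (linForm b _), linForm_mul_linForm]
  exact h.integrable_quad_sq fun k l => b k * b l

lemma integral_linForm_pow_four_le [DecidableEq ι] (h : IsStandardized μ) (b : ι → ℝ) :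
    ∫ x, (linForm b x ^ 2) ^ 2 ∂(Measure.pi fun _ : ι => μ)
      ≤ (2 + ∫ x, x ^ 4 ∂μ) * (∑ l, b l ^ 2) ^ 2 := by
  simp only [sq (linForm b _), linForm_mul_linForm]
  rw [h.integral_quad_sq (fun k l => b k * b l) (fun k l => mul_comm _ _)]
  set r := ∑ l, b l ^ 2 with hr
  have h1 : ∑ k, b k * b k = r := by simp only [hr, sq]
  have h2 : ∑ k, ∑ l, (b k * b l) ^ 2 = r ^ 2 := by
    rw [sq, hr, sum_mul_sum]
    simp only [mul_pow]
  have h3 : ∑ k, (b k * b k) ^ 2 ≤ r ^ 2 := by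
    rw [← h2]
    exact sum_le_sum fun k _ => single_le_sum (f := fun l => (b k * b l) ^ 2)
      (fun _ _ => sq_nonneg _) (mem_univ k)
  have h4 : 0 ≤ ∑ k, (b k * b k) ^ 2 := sum_nonneg fun _ _ => sq_nonneg _
  have h5 := h.one_le_integral_pow_four
  rw [h1, h2]
  nlinarith [mul_le_mul_of_nonneg_left h3 (by linarith : 0 ≤ (∫ x, x ^ 4 ∂μ) - 1)]

end IsStandardized

/-- A centered square integrable function of one variable. -/
structure IsCenteredL2 (μ : Measure ℝ) (ψ : ℝ → ℝ) : Prop where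
  measurable : Measurable ψ
  integrable_sq : Integrable (fun z => ψ z ^ 2) μ
  integral_eq_zero : ∫ z, ψ z ∂μ = 0

namespace IsCenteredL2

variable {μ : Measure ℝ} {ψ : ℝ → ℝ}

lemma integrable_mul (hψ : IsCenteredL2 μ ψ) {g : ℝ → ℝ} (hg : Measurable g)
    (hg2 : Integrable (fun z => g z ^ 2) μ) : Integrable (fun z => ψ z * g z) μ :=
  ((memLp_two_iff_integrable_sq hψ.measurable.aestronglyMeasurable).2
    hψ.integrable_sq).integrable_mul
    ((memLp_two_iff_integrable_sq hg.aestronglyMeasurable).2 hg2)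

lemma measurable_mul_linForm_sq (hψ : IsCenteredL2 μ ψ) (b : ι → ℝ) (k : ι) :
    Measurable fun x : ι → ℝ => ψ (x k) * linForm b x ^ 2 :=
  (hψ.measurable.comp (measurable_pi_apply k)).mul ((measurable_linForm b).pow_const 2)

lemma integrable_mul_sq (hψ : IsCenteredL2 μ ψ) (h : IsStandardized μ) :
    Integrable (fun z => ψ z * z ^ 2) μ :=
  hψ.integrable_mul (by fun_prop) (by simpa only [← pow_mul] using h.integrable_pow_four)

lemma integral_mul_sq_sq_le (hψ : IsCenteredL2 μ ψ) (h : IsStandardized μ) :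
    (∫ z, ψ z * z ^ 2 ∂μ) ^ 2 ≤ (∫ z, ψ z ^ 2 ∂μ) * ∫ z, z ^ 4 ∂μ := by
  have h4 : ∀ z : ℝ, (z ^ 2) ^ 2 = z ^ 4 := fun z => by ring
  have := integral_mul_sq_le (g := fun z => z ^ 2) hψ.integrable_sq
    (by simpa only [h4] using h.integrable_pow_four) (hψ.integrable_mul_sq h)
  simpa only [h4] using this

variable [IsProbabilityMeasure μ]

lemma integrable (hψ : IsCenteredL2 μ ψ) : Integrable ψ μ := by
  simpa using hψ.integrable_mul (g := fun _ => 1) measurable_const (by simp)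

lemma integrable_mul_id (hψ : IsCenteredL2 μ ψ) (h : IsStandardized μ) :
    Integrable (fun z => ψ z * z) μ := hψ.integrable_mul measurable_id h.integrable_pow_two

lemma integral_mul_id_sq_le (hψ : IsCenteredL2 μ ψ) (h : IsStandardized μ) :
    (∫ z, ψ z * z ∂μ) ^ 2 ≤ ∫ z, ψ z ^ 2 ∂μ := by
  have := integral_mul_sq_le hψ.integrable_sq h.integrable_pow_two (hψ.integrable_mul_id h)
  rwa [h.integral_sq, mul_one] at this

lemma integral_mul_affine_sq (hψ : IsCenteredL2 μ ψ) (h : IsStandardized μ) (u v : ℝ) :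
    ∫ z, ψ z * (u + v * z) ^ 2 ∂μ
      = 2 * u * v * (∫ z, ψ z * z ∂μ) + v ^ 2 * ∫ z, ψ z * z ^ 2 ∂μ := by
  have h1 : ∀ z, ψ z * (u + v * z) ^ 2
      = u ^ 2 * ψ z + 2 * u * v * (ψ z * z) + v ^ 2 * (ψ z * z ^ 2) := fun z => by ring
  simp only [h1]
  have i1 := hψ.integrable.const_mul (u ^ 2)
  have i2 := (hψ.integrable_mul_id h).const_mul (2 * u * v)
  have i3 := (hψ.integrable_mul_sq h).const_mul (v ^ 2)
  rw [integral_add (i1.fun_add i2) i3, integral_add i1 i2, integral_const_mul,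
    integral_const_mul, integral_const_mul, hψ.integral_eq_zero]
  ring

lemma memLp_mul_linForm_sq [DecidableEq ι] (hψ : IsCenteredL2 μ ψ) (h : IsStandardized μ)
    {b : ι → ℝ} {k : ι} (hb : b k = 0) :
    MemLp (fun x : ι → ℝ => ψ (x k) * linForm b x ^ 2) 2 (Measure.pi fun _ : ι => μ) := by
  rw [memLp_two_iff_integrable_sq (hψ.measurable_mul_linForm_sq b k).aestronglyMeasurable]
  simp only [mul_pow]
  refine integrable_mul_of_update_invariant (g := fun z => ψ z ^ 2)
    (G := fun x => (linForm b x ^ 2) ^ 2) (hψ.measurable.pow_const 2)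
    (((measurable_linForm b).pow_const 2).pow_const 2) hψ.integrable_sq
    (h.integrable_linForm_pow_four b) fun x z => by rw [linForm_update_of_eq_zero hb]

lemma integral_mul_linForm_sq_sq [DecidableEq ι] (hψ : IsCenteredL2 μ ψ) (h : IsStandardized μ)
    {b : ι → ℝ} {k : ι} (hb : b k = 0) :
    ∫ x : ι → ℝ, (ψ (x k) * linForm b x ^ 2) * (ψ (x k) * linForm b x ^ 2)
      ∂(Measure.pi fun _ : ι => μ)
      ≤ (∫ z, ψ z ^ 2 ∂μ) * ((2 + ∫ x, x ^ 4 ∂μ) * (∑ l, b l ^ 2) ^ 2) := by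
  simp only [← sq, mul_pow]
  rw [integral_mul_of_update_invariant (g := fun z => ψ z ^ 2)
    (G := fun x => (linForm b x ^ 2) ^ 2) (hψ.measurable.pow_const 2)
    (((measurable_linForm b).pow_const 2).pow_const 2)
    fun x z => by rw [linForm_update_of_eq_zero hb]]
  exact mul_le_mul_of_nonneg_left (h.integral_linForm_pow_four_le b)
    (integral_nonneg fun z => sq_nonneg _)

/-- The covariance of two distinct summands of `∑ ψ(x_k) T_k²`. -/
lemma integral_mul_linForm_sq_mul [DecidableEq ι] (hψ : IsCenteredL2 μ ψ) (h : IsStandardized μ)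
    {b d : ι → ℝ} {k j : ι} {v : ℝ} (hkj : k ≠ j) (hbk : b k = 0) (hdj : d j = 0) (hbj : b j = v)
    (hdk : d k = v) :
    ∫ x : ι → ℝ, (ψ (x k) * linForm b x ^ 2) * (ψ (x j) * linForm d x ^ 2)
      ∂(Measure.pi fun _ : ι => μ)
      = 4 * v ^ 2 * (∫ z, ψ z * z ∂μ) ^ 2 * (∑ l, b l * d l)
        + v ^ 4 * (∫ z, ψ z * z ^ 2 ∂μ) ^ 2 := by
  set α := ∫ z, ψ z * z ∂μ
  set β := ∫ z, ψ z * z ^ 2 ∂μ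
  have hF : Integrable (fun x : ι → ℝ => (ψ (x k) * linForm b x ^ 2) * (ψ (x j) * linForm d x ^ 2))
      (Measure.pi fun _ : ι => μ) :=
    (hψ.memLp_mul_linForm_sq h hbk).integrable_mul (hψ.memLp_mul_linForm_sq h hdj)
  have hstep : ∀ x : ι → ℝ, ∫ z, (ψ (update x k z k) * linForm b (update x k z) ^ 2)
      * (ψ (update x k z j) * linForm d (update x k z) ^ 2) ∂μ
      = (ψ (x j) * linForm b x ^ 2) * (2 * v * α * linForm (update d k 0) x + v ^ 2 * β) := by
    intro x
    have h1 : ∀ z, (ψ (update x k z k) * linForm b (update x k z) ^ 2)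
        * (ψ (update x k z j) * linForm d (update x k z) ^ 2)
        = (ψ (x j) * linForm b x ^ 2) * (ψ z * (linForm (update d k 0) x + v * z) ^ 2) := by
      intro z
      rw [update_self, update_of_ne hkj.symm, linForm_update_of_eq_zero hbk, linForm_update,
        linForm_update_left, hdk]
      ring
    simp only [h1]
    rw [integral_const_mul, hψ.integral_mul_affine_sq h]
    ring
  have hFi := (integrable_comp_update k hF).integral_prod_left
  rw [integral_eq_integral_update k hF]
  simp only [hstep] at hFi ⊢
  rw [integral_eq_integral_update j hFi]
  have hdj' : update d k 0 j = 0 := by rw [update_of_ne hkj.symm, hdj]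
  have hstep2 : ∀ x : ι → ℝ, ∫ z, (ψ (update x j z j) * linForm b (update x j z) ^ 2)
      * (2 * v * α * linForm (update d k 0) (update x j z) + v ^ 2 * β) ∂μ
      = 4 * v ^ 2 * α ^ 2 * (linForm (update b j 0) x * linForm (update d k 0) x)
        + 2 * v ^ 3 * α * β * linForm (update b j 0) x
        + 2 * v ^ 3 * α * β * linForm (update d k 0) x + v ^ 4 * β ^ 2 := by
    intro x
    have h1 : ∀ z, (ψ (update x j z j) * linForm b (update x j z) ^ 2)
        * (2 * v * α * linForm (update d k 0) (update x j z) + v ^ 2 * β)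
        = (2 * v * α * linForm (update d k 0) x + v ^ 2 * β)
          * (ψ z * (linForm (update b j 0) x + v * z) ^ 2) := by
      intro z
      rw [update_self, linForm_update_of_eq_zero hdj', linForm_update,
        linForm_update_left b x j, hbj]
      ring
    simp only [h1]
    rw [integral_const_mul, hψ.integral_mul_affine_sq h]
    ring
  simp only [hstep2]
  have i1 := (h.integrable_linForm_mul (update b j 0) (update d k 0)).const_mul
    (4 * v ^ 2 * α ^ 2)
  have i2 := (h.integrable_linForm (update b j 0)).const_mul (2 * v ^ 3 * α * β)
  have i3 := (h.integrable_linForm (update d k 0)).const_mul (2 * v ^ 3 * α * β)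
  rw [integral_add ((i1.fun_add i2).fun_add i3) (integrable_const _),
    integral_add (i1.fun_add i2) i3, integral_add i1 i2, integral_const_mul, integral_const_mul,
    integral_const_mul, h.integral_linForm, h.integral_linForm, h.integral_linForm_mul]
  have hsum : ∑ l, update b j 0 l * update d k 0 l = ∑ l, b l * d l := by
    refine sum_congr rfl fun l _ => ?_
    by_cases hlj : l = j
    · subst hlj; simp [hdj]
    · by_cases hlk : l = k
      · subst hlk; simp [hbk]
      · rw [update_of_ne hlj, update_of_ne hlk]
  rw [hsum]
  simp

/-- Second moment of `∑ ψ(x_k) T_k²`, where `T_k = ∑ a_{k,l} x_l`. -/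
lemma integral_sum_mul_linForm_sq_sq_le [DecidableEq ι] (hψ : IsCenteredL2 μ ψ)
    (h : IsStandardized μ) {a : ι → ι → ℝ} (hsymm : ∀ k l, a k l = a l k)
    (hdiag : ∀ k, a k k = 0) {L : ℝ} (hL : ∀ k, ∑ l, a k l ^ 2 ≤ L) :
    ∫ x : ι → ℝ, (∑ k, ψ (x k) * linForm (a k) x ^ 2) ^ 2 ∂(Measure.pi fun _ : ι => μ)
      ≤ (∫ z, ψ z ^ 2 ∂μ) * L * (6 + 2 * ∫ x, x ^ 4 ∂μ) * ∑ k, ∑ l, a k l ^ 2 := by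
  set p := ∫ z, ψ z ^ 2 ∂μ with hp
  set m := ∫ x, x ^ 4 ∂μ with hm
  have hp0 : 0 ≤ p := integral_nonneg fun z => sq_nonneg _
  have hm1 : 1 ≤ m := h.one_le_integral_pow_four
  simp only [sq (∑ k, _), sum_mul_sum]
  have hint : ∀ k j, Integrable (fun x : ι → ℝ => (ψ (x k) * linForm (a k) x ^ 2)
      * (ψ (x j) * linForm (a j) x ^ 2)) (Measure.pi fun _ : ι => μ) := fun k j =>
    (hψ.memLp_mul_linForm_sq h (hdiag k)).integrable_mul (hψ.memLp_mul_linForm_sq h (hdiag j))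
  rw [integral_finsetSum _ fun k _ => integrable_finsetSum _ fun j _ => hint k j]
  have hterm : ∀ k j, ∫ x : ι → ℝ, (ψ (x k) * linForm (a k) x ^ 2)
      * (ψ (x j) * linForm (a j) x ^ 2) ∂(Measure.pi fun _ : ι => μ)
      ≤ (if k = j then p * (2 + m) * L * (∑ l, a k l ^ 2) else 0)
        + p * L * (4 + m) * a k j ^ 2 := by
    intro k j
    have hL0 : 0 ≤ L := (sum_nonneg fun _ _ => sq_nonneg _).trans (hL k)
    by_cases hkj : k = j
    · subst hkj
      refine (hψ.integral_mul_linForm_sq_sq h (hdiag k)).trans ?_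
      rw [if_pos rfl, hdiag k, sq (∑ l, a k l ^ 2)]
      have h1 : 0 ≤ ∑ l, a k l ^ 2 := sum_nonneg fun _ _ => sq_nonneg _
      have h2 := mul_le_mul_of_nonneg_left (mul_le_mul_of_nonneg_right (hL k) h1)
        (by positivity : 0 ≤ p * (2 + m))
      linarith
    · rw [if_neg hkj, hψ.integral_mul_linForm_sq_mul h hkj (hdiag k) (hdiag j) rfl (hsymm j k)]
      have h1 : ∑ l, a k l * a j l ≤ L := by
        have : ∑ l, a k l * a j l ≤ ∑ l, (a k l ^ 2 / 2 + a j l ^ 2 / 2) :=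
          sum_le_sum fun l _ => by nlinarith [sq_nonneg (a k l - a j l)]
        rw [sum_add_distrib, ← sum_div, ← sum_div] at this
        linarith [hL k, hL j]
      have h2 : a k j ^ 2 ≤ L := (single_le_sum (f := fun l => a k l ^ 2)
        (fun _ _ => sq_nonneg _) (mem_univ j)).trans (hL k)
      have hα := hψ.integral_mul_id_sq_le h
      have hβ := hψ.integral_mul_sq_sq_le h
      rw [← hp] at hα hβ
      rw [← hm] at hβ
      have h3 : 4 * a k j ^ 2 * (∫ z, ψ z * z ∂μ) ^ 2 * (∑ l, a k l * a j l)
          ≤ 4 * a k j ^ 2 * p * L :=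
        (mul_le_mul_of_nonneg_left h1 (by positivity)).trans (by gcongr)
      have h4 : a k j ^ 4 * (∫ z, ψ z * z ^ 2 ∂μ) ^ 2 ≤ (a k j ^ 2 * L) * (p * m) := by
        have : a k j ^ 4 = a k j ^ 2 * a k j ^ 2 := by ring
        rw [this]
        gcongr
      linarith
  refine (sum_le_sum fun k _ => (integral_finsetSum _ fun j _ => hint k j).le.trans
    (sum_le_sum fun j _ => hterm k j)).trans (le_of_eq ?_)
  simp only [sum_add_distrib, sum_ite_eq, mem_univ, if_true, ← mul_sum]
  ring

end IsCenteredL2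

end

noncomputable section

open Function Finset

section QuadraticForm

variable {ι : Type*} [Fintype ι]

/-- The quadratic form with coefficients `a`, as a function of its variables. -/
def quadFun (a : ι → ι → ℝ) (x : ι → ℝ) : ℝ := ∑ k, ∑ l, a k l * x k * x l

lemma quadFun_eq (a : ι → ι → ℝ) (x : ι → ℝ) : quadFun a x = ∑ k, x k * linForm (a k) x := by
  unfold quadFun linForm
  refine sum_congr rfl fun k _ => ?_
  rw [mul_sum]
  exact sum_congr rfl fun l _ => by ring

lemma measurable_quadFun (a : ι → ι → ℝ) : Measurable (quadFun a) := by
  unfold quadFun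
  fun_prop

lemma quadFun_update [DecidableEq ι] {a : ι → ι → ℝ} (hsymm : ∀ k l, a k l = a l k)
    (hdiag : ∀ k, a k k = 0) (x : ι → ℝ) (k : ι) (z : ℝ) :
    quadFun a (update x k z) = quadFun a x + 2 * (z - x k) * linForm (a k) x := by
  have h1 : ∀ y : ι → ℝ, ∑ l, y l * linForm (a l) x = linForm (fun l => linForm (a l) x) y :=
    fun y => sum_congr rfl fun l _ => mul_comm _ _
  have h2 : ∑ l, update x k z l * (a l k * (z - x k))
      = (z - x k) * linForm (a k) (update x k z) := by
    rw [linForm, mul_sum]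
    exact sum_congr rfl fun l _ => by rw [hsymm l k]; ring
  rw [quadFun_eq, quadFun_eq]
  simp only [linForm_update (a _), mul_add, sum_add_distrib]
  rw [h1, h1, h2, linForm_update, linForm_update_of_eq_zero (hdiag k)]
  ring

/-- The Stein kernel of the quadratic form, `2 ∑ φ(x_k) T_k²` with `T_k = ∑ a_{k,l} x_l`. -/
def quadKernel (φ : ℝ → ℝ) (a : ι → ι → ℝ) (x : ι → ℝ) : ℝ :=
  2 * ∑ k, φ (x k) * linForm (a k) x ^ 2

variable {μ : Measure ℝ} [IsProbabilityMeasure μ]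

lemma integrable_quadFun_sq (h : IsStandardized μ) (a : ι → ι → ℝ) :
    Integrable (fun x => quadFun a x ^ 2) (Measure.pi fun _ : ι => μ) := by
  simp only [quadFun]
  exact h.integrable_quad_sq a

lemma sum_linForm_sq (a : ι → ι → ℝ) (x : ι → ℝ) :
    2 * ∑ k, linForm (a k) x ^ 2 = ∑ q, ∑ l, (2 * ∑ k, a k q * a k l) * x q * x l := by
  simp only [sq, linForm_mul_linForm, mul_sum, sum_mul]
  rw [sum_comm]
  refine sum_congr rfl fun q _ => ?_
  rw [sum_comm]
  exact sum_congr rfl fun l _ => sum_congr rfl fun k _ => by ring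

variable [DecidableEq ι]

lemma integrable_mul_linForm_sq (h : IsStandardized μ) {φ : ℝ → ℝ} (hφm : Measurable φ)
    (hφ : Integrable φ μ) {b : ι → ℝ} {k : ι} (hb : b k = 0) :
    Integrable (fun x : ι → ℝ => φ (x k) * linForm b x ^ 2) (Measure.pi fun _ : ι => μ) :=
  integrable_mul_of_update_invariant hφm ((measurable_linForm b).pow_const 2) hφ
    (by simpa only [sq] using h.integrable_linForm_mul b b)
    fun x z => by rw [linForm_update_of_eq_zero hb]

lemma integrable_quadKernel (h : IsStandardized μ) {φ : ℝ → ℝ} (hφm : Measurable φ)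
    (hφ : Integrable φ μ) {a : ι → ι → ℝ} (hdiag : ∀ k, a k k = 0) :
    Integrable (quadKernel φ a) (Measure.pi fun _ : ι => μ) :=
  (integrable_finsetSum _ fun k _ => integrable_mul_linForm_sq h hφm hφ (hdiag k)).const_mul 2

theorem isSteinKernelOf_quadFun (h : IsStandardized μ)
    (hs : ContDiffOn ℝ 1 (quantile μ) (Set.Ioo 0 1)) (hφ : Integrable (steinKernel μ) μ)
    {a : ι → ι → ℝ} (hsymm : ∀ k l, a k l = a l k) (hdiag : ∀ k, a k k = 0) :
    IsSteinKernelOf (Measure.pi fun _ : ι => μ) (quadFun a) (quadKernel (steinKernel μ) a) := by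
  intro f f' C hf hf' hC
  have hfc : Continuous f := continuous_iff_continuousAt.2 fun x => (hf x).continuousAt
  have hφm := measurable_steinKernel μ
  have hQ2 : MemLp (quadFun a) 2 (Measure.pi fun _ : ι => μ) :=
    (memLp_two_iff_integrable_sq (measurable_quadFun a).aestronglyMeasurable).2
      (integrable_quadFun_sq h a)
  have hfQ : MemLp (fun x => f (quadFun a x)) 2 (Measure.pi fun _ : ι => μ) := by
    have hc : MemLp (fun _ : ι → ℝ => |f 0|) 2 (Measure.pi fun _ : ι => μ) := memLp_const _
    have hq : MemLp (fun x => C * |quadFun a x|) 2 (Measure.pi fun _ : ι => μ) :=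
      MemLp.const_mul hQ2.norm C
    have hdom : MemLp (fun x => |f 0| + C * |quadFun a x|) 2 (Measure.pi fun _ : ι => μ) :=
      hc.add hq
    exact hdom.mono' (hfc.measurable.comp (measurable_quadFun a)).aestronglyMeasurable
      (ae_of_all _ fun x => abs_le_of_hasDerivAt_bounded hf hC _)
  have hT : ∀ k, Integrable (fun x : ι → ℝ => x k * linForm (a k) x * f (quadFun a x))
      (Measure.pi fun _ : ι => μ) := by
    intro k
    refine MemLp.integrable_mul (p := 2) (q := 2) ?_ hfQ
    have hm : Measurable fun x : ι → ℝ => x k * linForm (a k) x :=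
      (measurable_pi_apply k).mul (measurable_linForm _)
    rw [memLp_two_iff_integrable_sq hm.aestronglyMeasurable]
    simp only [mul_pow]
    exact integrable_mul_linForm_sq h (φ := fun z => z ^ 2) (by fun_prop) h.integrable_pow_two
      (hdiag k)
  have hK : ∀ k, Integrable
      (fun x : ι → ℝ => steinKernel μ (x k) * linForm (a k) x ^ 2 * f' (quadFun a x))
      (Measure.pi fun _ : ι => μ) := fun k =>
    (integrable_mul_linForm_sq h hφm hφ (hdiag k)).mul_bdd
      (hf'.measurable.comp (measurable_quadFun a)).aestronglyMeasurable (ae_of_all _ fun x => hC _)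
  have hterm : ∀ k, ∫ x : ι → ℝ, x k * linForm (a k) x * f (quadFun a x)
      ∂(Measure.pi fun _ : ι => μ) = 2 * ∫ x : ι → ℝ,
        steinKernel μ (x k) * linForm (a k) x ^ 2 * f' (quadFun a x)
        ∂(Measure.pi fun _ : ι => μ) := by
    intro k
    rw [integral_eq_integral_update k (hT k), integral_eq_integral_update k (hK k),
      ← integral_const_mul]
    refine integral_congr_ae (ae_of_all _ fun x => ?_)
    simp only [update_self, linForm_update_of_eq_zero (hdiag k), quadFun_update hsymm hdiag]
    set T := linForm (a k) x
    have hg : ∀ z, HasDerivAt (fun z => f (quadFun a x + 2 * (z - x k) * T))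
        (f' (quadFun a x + 2 * (z - x k) * T) * (2 * T)) z := by
      intro z
      refine (hf _).comp z ?_
      refine (((((hasDerivAt_id z).sub_const (x k)).const_mul 2).mul_const T).const_add
        (quadFun a x)).congr_deriv ?_
      ring
    have key := integral_mul_eq_integral_steinKernel_mul hs h.integrable_pow_two h.integral_id hφ
      (C := C * |2 * T|) hg (by fun_prop) (fun z => by
        rw [abs_mul]
        exact mul_le_mul_of_nonneg_right (hC _) (abs_nonneg _))
    calc ∫ z, z * T * f (quadFun a x + 2 * (z - x k) * T) ∂μ
        = T * ∫ z, z * f (quadFun a x + 2 * (z - x k) * T) ∂μ := by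
          rw [← integral_const_mul]
          exact integral_congr_ae (ae_of_all _ fun z => by ring)
      _ = 2 * ∫ z, steinKernel μ z * T ^ 2 * f' (quadFun a x + 2 * (z - x k) * T) ∂μ := by
          rw [key, ← integral_const_mul, ← integral_const_mul]
          exact integral_congr_ae (ae_of_all _ fun z => by ring)
  have hl : ∀ x, quadFun a x * f (quadFun a x)
      = ∑ k, x k * linForm (a k) x * f (quadFun a x) := fun x => by
    rw [← sum_mul, ← quadFun_eq]
  have hr : ∀ x, quadKernel (steinKernel μ) a x * f' (quadFun a x)
      = ∑ k, 2 * (steinKernel μ (x k) * linForm (a k) x ^ 2 * f' (quadFun a x)) := fun x => by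
    rw [← mul_sum, ← sum_mul, quadKernel]
    ring
  simp only [hl, hr]
  rw [integral_finsetSum _ fun k _ => hT k, integral_finsetSum _ fun k _ => (hK k).const_mul 2]
  simp only [hterm, integral_const_mul]

/-- Second moment of the centered quadratic form `2 ∑ T_k²`. -/
lemma integral_sum_linForm_sq_sub_one_sq_le (h : IsStandardized μ) {a : ι → ι → ℝ}
    (hsymm : ∀ k l, a k l = a l k) {L : ℝ} (hL : ∀ k, ∑ l, a k l ^ 2 ≤ L)
    (hS : ∑ k, ∑ l, a k l ^ 2 = 1 / 2) :
    Integrable (fun x : ι → ℝ => (2 * ∑ k, linForm (a k) x ^ 2 - 1) ^ 2)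
      (Measure.pi fun _ : ι => μ) ∧
    ∫ x : ι → ℝ, (2 * ∑ k, linForm (a k) x ^ 2 - 1) ^ 2 ∂(Measure.pi fun _ : ι => μ)
      ≤ 8 * (∑ q, ∑ l, (∑ k, a k q * a k l) ^ 2) + 2 * (∫ x, x ^ 4 ∂μ) * L := by
  set c : ι → ι → ℝ := fun q l => 2 * ∑ k, a k q * a k l with hc
  have hcs : ∀ q l, c q l = c l q := fun q l => by
    simp only [hc, mul_comm]
  have hB2 := h.integrable_quad_sq c
  have hB1 : Integrable (fun x : ι → ℝ => ∑ q, ∑ l, c q l * x q * x l)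
      (Measure.pi fun _ : ι => μ) :=
    integrable_finsetSum _ fun q _ => integrable_finsetSum _ fun l _ => by
      simpa only [mul_assoc] using (h.integrable_mul_two q l).const_mul (c q l)
  have hexp : ∀ x : ι → ℝ, (2 * ∑ k, linForm (a k) x ^ 2 - 1) ^ 2
      = (∑ q, ∑ l, c q l * x q * x l) ^ 2 - 2 * (∑ q, ∑ l, c q l * x q * x l) + 1 := fun x => by
    rw [sum_linForm_sq]
    ring
  have hrow : ∀ q, ∑ k, a k q * a k q = ∑ k, a q k ^ 2 := fun q =>
    sum_congr rfl fun k _ => by rw [hsymm k q, sq]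
  have htr : ∑ q, c q q = 1 := by
    simp only [hc, hrow, ← mul_sum, hS]
    norm_num
  simp only [hexp]
  have hi : Integrable (fun x : ι → ℝ => (∑ q, ∑ l, c q l * x q * x l) ^ 2
      - 2 * ∑ q, ∑ l, c q l * x q * x l) (Measure.pi fun _ : ι => μ) := hB2.sub (hB1.const_mul 2)
  refine ⟨hi.add (integrable_const 1), ?_⟩
  rw [integral_add hi (integrable_const 1), integral_sub hB2 (hB1.const_mul 2),
    integral_const_mul, h.integral_quad, h.integral_quad_sq c hcs, htr]
  have h1 : ∑ q, ∑ l, c q l ^ 2 = 4 * ∑ q, ∑ l, (∑ k, a k q * a k l) ^ 2 := by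
    simp only [hc, mul_pow, ← mul_sum]
    norm_num
  have h2 : ∑ q, c q q ^ 2 ≤ 2 * L := by
    have : ∀ q ∈ univ, c q q ^ 2 ≤ 4 * L * ∑ k, a q k ^ 2 := by
      intro q _
      have h0 : 0 ≤ ∑ k, a q k ^ 2 := sum_nonneg fun _ _ => sq_nonneg _
      simp only [hc, hrow]
      nlinarith [hL q]
    have := sum_le_sum this
    rw [← mul_sum, hS] at this
    linarith
  have h3 : 0 ≤ ∑ q, c q q ^ 2 := sum_nonneg fun _ _ => sq_nonneg _
  have h4 := h.one_le_integral_pow_four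
  have h5 := mul_le_mul_of_nonneg_left h2 (by linarith : 0 ≤ ∫ x, x ^ 4 ∂μ)
  rw [h1]
  simp
  nlinarith

/-- The variance of the Stein kernel of the quadratic form. -/
theorem integral_one_sub_quadKernel_sq_le (h : IsStandardized μ) {φ : ℝ → ℝ} (hφm : Measurable φ)
    (hφ2 : Integrable (fun z => φ z ^ 2) μ) (hφ1 : ∫ z, φ z ∂μ = 1) {a : ι → ι → ℝ}
    (hsymm : ∀ k l, a k l = a l k) (hdiag : ∀ k, a k k = 0) {L : ℝ}
    (hL : ∀ k, ∑ l, a k l ^ 2 ≤ L) (hL0 : 0 ≤ L) (hS : ∑ k, ∑ l, a k l ^ 2 = 1 / 2) :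
    Integrable (fun x => (1 - quadKernel φ a x) ^ 2) (Measure.pi fun _ : ι => μ) ∧
    ∫ x, (1 - quadKernel φ a x) ^ 2 ∂(Measure.pi fun _ : ι => μ)
      ≤ 16 * ((∫ z, φ z ^ 2 ∂μ) * (2 + ∫ x, x ^ 4 ∂μ) * L
        + ∑ q, ∑ l, (∑ k, a k q * a k l) ^ 2) := by
  have hφL : MemLp φ 2 μ := (memLp_two_iff_integrable_sq hφm.aestronglyMeasurable).2 hφ2
  have hφi : Integrable φ μ := hφL.integrable one_le_two
  set ψ : ℝ → ℝ := fun z => φ z - 1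
  have hψ2 : ∀ z, ψ z ^ 2 = φ z ^ 2 - 2 * φ z + 1 := fun z => by simp only [ψ]; ring
  have hi : Integrable (fun z => φ z ^ 2 - 2 * φ z) μ := hφ2.sub (hφi.const_mul 2)
  have hψ : IsCenteredL2 μ ψ := by
    refine ⟨hφm.sub_const 1, ?_, ?_⟩
    · simp only [hψ2]
      exact hi.add (integrable_const 1)
    · rw [integral_sub hφi (integrable_const 1), hφ1]
      simp
  have hψp : ∫ z, ψ z ^ 2 ∂μ = (∫ z, φ z ^ 2 ∂μ) - 1 := by
    simp only [hψ2]
    rw [integral_add hi (integrable_const 1), integral_sub hφ2 (hφi.const_mul 2),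
      integral_const_mul, hφ1]
    simp
    ring
  have hA := hψ.integral_sum_mul_linForm_sq_sq_le h hsymm hdiag hL
  have hAm : MemLp (fun x : ι → ℝ => ∑ k, ψ (x k) * linForm (a k) x ^ 2) 2
      (Measure.pi fun _ : ι => μ) :=
    memLp_finsetSum _ fun k _ => hψ.memLp_mul_linForm_sq h (hdiag k)
  have hAi := hAm.integrable_sq
  obtain ⟨hBi, hB⟩ := integral_sum_linForm_sq_sub_one_sq_le h hsymm hL hS
  have hdec : ∀ x : ι → ℝ, (1 - quadKernel φ a x) ^ 2
      ≤ 8 * (∑ k, ψ (x k) * linForm (a k) x ^ 2) ^ 2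
        + 2 * (2 * ∑ k, linForm (a k) x ^ 2 - 1) ^ 2 := by
    intro x
    have h1 : ∑ k, φ (x k) * linForm (a k) x ^ 2
        = ∑ k, ψ (x k) * linForm (a k) x ^ 2 + ∑ k, linForm (a k) x ^ 2 := by
      rw [← sum_add_distrib]
      exact sum_congr rfl fun k _ => by simp only [ψ]; ring
    rw [quadKernel, h1]
    nlinarith [sq_nonneg (2 * ∑ k, ψ (x k) * linForm (a k) x ^ 2
      - (2 * ∑ k, linForm (a k) x ^ 2 - 1))]
  have hdi := (hAi.const_mul 8).fun_add (hBi.const_mul 2)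
  have hm : Measurable (quadKernel φ a) := by
    unfold quadKernel
    refine (Finset.measurable_sum _ fun k _ => ?_).const_mul 2
    exact (hφm.comp (measurable_pi_apply k)).mul ((measurable_linForm _).pow_const 2)
  have hint : Integrable (fun x => (1 - quadKernel φ a x) ^ 2) (Measure.pi fun _ : ι => μ) := by
    refine hdi.mono' ((measurable_const.sub hm).pow_const 2).aestronglyMeasurable
      (ae_of_all _ fun x => ?_)
    rw [Real.norm_eq_abs, abs_of_nonneg (sq_nonneg _)]
    exact hdec x
  refine ⟨hint, (integral_mono hint hdi hdec).trans ?_⟩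
  rw [integral_add (hAi.const_mul 8) (hBi.const_mul 2), integral_const_mul, integral_const_mul]
  rw [hψp, hS] at hA
  have hp : 0 ≤ (∫ z, φ z ^ 2 ∂μ) - 1 := by
    rw [← hψp]
    exact integral_nonneg fun z => sq_nonneg _
  have hm4 := h.one_le_integral_pow_four
  have h1 : 0 ≤ ((∫ z, φ z ^ 2 ∂μ) - 1) * L := mul_nonneg hp hL0
  have h2 : 0 ≤ ((∫ z, φ z ^ 2 ∂μ) - 1) * L * ∫ x, x ^ 4 ∂μ := mul_nonneg h1 (by linarith)
  have h3 : 0 ≤ L * ∫ x, x ^ 4 ∂μ := mul_nonneg hL0 (by linarith)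
  nlinarith

end QuadraticForm

end

noncomputable section

open Finset

lemma sum_sq_le_contractionTerm {n : ℕ} (a : Matrix (Fin n) (Fin n) ℝ) (ha : a.IsSymm) :
    ∑ q, ∑ l, (∑ k, a k q * a k l) ^ 2 ≤ contractionTerm a := by
  have h : ∑ k, (∑ l with l < k, a k l ^ 2) ^ 2 ≤ ∑ q, ∑ l, (∑ k, a k q * a k l) ^ 2 := by
    refine sum_le_sum fun q _ => le_trans ?_ (single_le_sum
      (f := fun l => (∑ k, a k q * a k l) ^ 2) (fun _ _ => sq_nonneg _) (mem_univ q))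
    have h2 : ∑ k, a k q * a k q = ∑ l, a q l ^ 2 :=
      sum_congr rfl fun k _ => by rw [ha.apply q k, sq]
    simp only [h2]
    gcongr
    exact filter_subset _ _
  unfold contractionTerm
  linarith

lemma sum_sq_le_maxRowSq {n : ℕ} (a : Matrix (Fin n) (Fin n) ℝ) (k : Fin n) :
    ∑ l, a k l ^ 2 ≤ maxRowSq a :=
  le_ciSup (f := fun k => ∑ l, a k l ^ 2) (Set.finite_range _).bddAbove k

lemma maxRowSq_pos {n : ℕ} {a : Matrix (Fin n) (Fin n) ℝ} (ha : a ≠ 0) : 0 < maxRowSq a := by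
  by_contra! h
  refine ha ?_
  ext k l
  have h1 : a k l ^ 2 ≤ 0 := ((single_le_sum (f := fun l => a k l ^ 2)
    (fun _ _ => sq_nonneg _) (mem_univ l)).trans (sum_sq_le_maxRowSq a k)).trans h
  exact pow_eq_zero_iff two_ne_zero |>.1 (le_antisymm h1 (sq_nonneg _))

lemma boundRoot_eq_top {μ : Measure ℝ} {n : ℕ} {a : Matrix (Fin n) (Fin n) ℝ} (ha : a ≠ 0)
    (h0 : ∫⁻ x, ENNReal.ofReal (steinKernel μ x ^ 2) ∂μ ≠ 0)
    (h : ∫⁻ x, ENNReal.ofReal (steinKernel μ x ^ 2) ∂μ = ∞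
      ∨ ∫⁻ x, ENNReal.ofReal (x ^ 4) ∂μ = ∞) : boundRoot μ a = ∞ := by
  have hL : ENNReal.ofReal (maxRowSq a) ≠ 0 := by
    simpa using maxRowSq_pos ha
  have hmul : (∫⁻ x, ENNReal.ofReal (steinKernel μ x ^ 2) ∂μ)
      * (2 + ∫⁻ x, ENNReal.ofReal (x ^ 4) ∂μ) = ∞ := by
    rcases h with h | h
    · rw [h, ENNReal.top_mul]
      simp
    · rw [h, add_top, ENNReal.mul_top h0]
  rw [boundRoot, hmul, ENNReal.top_mul hL, top_add, ENNReal.top_rpow_of_pos (by norm_num)]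

lemma boundRoot_eq_ofReal {μ : Measure ℝ} {n : ℕ} (a : Matrix (Fin n) (Fin n) ℝ)
    (hp : Integrable (fun x => steinKernel μ x ^ 2) μ) (hm : Integrable (fun x => x ^ 4) μ)
    (hL : 0 ≤ maxRowSq a) (hc : 0 ≤ contractionTerm a) :
    boundRoot μ a = ENNReal.ofReal (√((∫ x, steinKernel μ x ^ 2 ∂μ) * (2 + ∫ x, x ^ 4 ∂μ)
      * maxRowSq a + contractionTerm a)) := by
  have hp0 : 0 ≤ ∫ x, steinKernel μ x ^ 2 ∂μ := integral_nonneg fun x => sq_nonneg _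
  have hm0 : 0 ≤ ∫ x, x ^ 4 ∂μ := integral_nonneg fun x => by positivity
  have e2 : (2 : ℝ≥0∞) = ENNReal.ofReal 2 := by simp
  rw [boundRoot, ← ofReal_integral_eq_lintegral_ofReal hp (ae_of_all _ fun x => sq_nonneg _),
    ← ofReal_integral_eq_lintegral_ofReal hm (ae_of_all _ fun x => by positivity), e2,
    ← ENNReal.ofReal_add (by norm_num) hm0, ← ENNReal.ofReal_mul hp0,
    ← ENNReal.ofReal_mul (by positivity), ← ENNReal.ofReal_add (by positivity) hc,
    ENNReal.ofReal_rpow_of_nonneg (by positivity) (by norm_num), Real.sqrt_eq_rpow]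

lemma integrable_of_lintegral_ne_top {μ : Measure ℝ} {f : ℝ → ℝ} (hf : Measurable f)
    (h0 : ∀ x, 0 ≤ f x) (h : ∫⁻ x, ENNReal.ofReal (f x) ∂μ ≠ ∞) : Integrable f μ :=
  (lintegral_ofReal_ne_top_iff_integrable hf.aestronglyMeasurable (ae_of_all _ h0)).1 h

/-- The first absolute moment is at most the root of the second moment. -/
lemma integral_abs_le_of_integral_sq_le {Ω : Type*} [MeasurableSpace Ω] {P : Measure Ω}
    [IsProbabilityMeasure P] {Y : Ω → ℝ} (hY : Integrable Y P)
    (hY2 : Integrable (fun ω => Y ω ^ 2) P) {R : ℝ} (h : ∫ ω, Y ω ^ 2 ∂P ≤ 16 * R) :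
    ∫ ω, |Y ω| ∂P ≤ 4 * √R := by
  have h1 := integral_mul_sq_le (f := fun ω => |Y ω|) (g := fun _ => 1)
    (by simpa only [sq_abs] using hY2) (integrable_const _) (by simpa using hY.abs)
  simp only [mul_one, sq_abs, one_pow, integral_const, probReal_univ, smul_eq_mul] at h1
  have h2 : 4 * √R = √(16 * R) := by
    rw [Real.sqrt_mul (by norm_num)]
    congr 1
    rw [show (16 : ℝ) = 4 ^ 2 by norm_num, Real.sqrt_sq (by norm_num)]
  rw [h2]
  exact Real.le_sqrt_of_sq_le (h1.trans h)

/-- The Gaussian approximation bounds for a quadratic form on a product space. -/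
theorem quadFun_gaussian_bounds {μ : Measure ℝ} [IsProbabilityMeasure μ]
    (hs : ContDiffOn ℝ 1 (quantile μ) (Set.Ioo 0 1)) (hmean : ∫ x, x ∂μ = 0)
    (hvar : ∫ x, x ^ 2 ∂μ = 1) {n : ℕ} {a : Matrix (Fin n) (Fin n) ℝ} (hsymm : a.IsSymm)
    (hdiag : ∀ k, a k k = 0)
    (hnorm : ∫ x, quadFun a x ^ 2 ∂(Measure.pi fun _ : Fin n => μ) = 1) :
    wassersteinDist ((Measure.pi fun _ : Fin n => μ).map (quadFun a)) (gaussianReal 0 1)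
        ≤ 4 * boundRoot μ a
    ∧ totalVariationDist ((Measure.pi fun _ : Fin n => μ).map (quadFun a)) (gaussianReal 0 1)
        ≤ 8 * boundRoot μ a := by
  have ha0 : a ≠ 0 := by
    rintro rfl
    simp [quadFun] at hnorm
  have hx2 : Integrable (fun x => x ^ 2) μ := by
    by_contra h
    rw [integral_undef h] at hvar
    exact zero_ne_one hvar
  have hφm := measurable_steinKernel μ
  by_cases htop : ∫⁻ x, ENNReal.ofReal (steinKernel μ x ^ 2) ∂μ = ∞
      ∨ ∫⁻ x, ENNReal.ofReal (x ^ 4) ∂μ = ∞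
  · have h0 : ∫⁻ x, ENNReal.ofReal (steinKernel μ x ^ 2) ∂μ ≠ 0 := by
      intro h
      rw [lintegral_eq_zero_iff (hφm.pow_const 2).ennreal_ofReal] at h
      have hz : steinKernel μ =ᵐ[μ] 0 := by
        filter_upwards [h] with x hx
        have : steinKernel μ x ^ 2 ≤ 0 := by simpa using hx
        exact pow_eq_zero_iff two_ne_zero |>.1 (le_antisymm this (sq_nonneg _))
      have h1 := integral_steinKernel hs hx2 hmean ((integrable_zero _ _ _).congr hz.symm)
      rw [hvar, integral_congr_ae hz] at h1
      simp at h1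
    rw [boundRoot_eq_top ha0 h0 htop]
    constructor <;> rw [ENNReal.mul_top (by norm_num)] <;> exact le_top
  push Not at htop
  have hφ2 : Integrable (fun x => steinKernel μ x ^ 2) μ :=
    integrable_of_lintegral_ne_top (hφm.pow_const 2) (fun x => sq_nonneg _) htop.1
  have h4 : Integrable (fun x : ℝ => x ^ 4) μ :=
    integrable_of_lintegral_ne_top (by fun_prop) (fun x => by positivity) htop.2
  have hφ : Integrable (steinKernel μ) μ :=
    ((memLp_two_iff_integrable_sq hφm.aestronglyMeasurable).2 hφ2).integrable one_le_two
  have hst : IsStandardized μ := ⟨hmean, hvar, h4⟩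
  have hsy : ∀ k l, a k l = a l k := fun k l => hsymm.apply l k
  have hS : ∑ k, ∑ l, a k l ^ 2 = 1 / 2 := by
    have h := hst.integral_quad_sq a hsy
    simp only [quadFun] at hnorm
    rw [hnorm] at h
    simp only [hdiag] at h
    simp at h
    linarith
  have hL := maxRowSq_pos ha0
  have hc := contractionTerm_nonneg a hsymm
  obtain ⟨hH2, hH⟩ := integral_one_sub_quadKernel_sq_le hst hφm hφ2
    ((integral_steinKernel hs hx2 hmean hφ).trans hvar) hsy hdiag (sum_sq_le_maxRowSq a) hL.le hS
  have hHi := integrable_quadKernel hst hφm hφ hdiag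
  have habs := integral_abs_le_of_integral_sq_le ((integrable_const 1).sub hHi) hH2
    (hH.trans (mul_le_mul_of_nonneg_left (add_le_add_right (sum_sq_le_contractionTerm a hsymm) _)
      (by norm_num)))
  have hker := isSteinKernelOf_quadFun hst hs hφ hsy hdiag
  have hQ2 := integrable_quadFun_sq hst a
  have e4 : (4 : ℝ≥0∞) = ENNReal.ofReal 4 := by simp
  have e8 : (8 : ℝ≥0∞) = ENNReal.ofReal 8 := by simp
  rw [boundRoot_eq_ofReal a hφ2 h4 hL.le hc, e4, e8, ← ENNReal.ofReal_mul (by norm_num),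
    ← ENNReal.ofReal_mul (by norm_num)]
  refine ⟨(wassersteinDist_gaussian_le (measurable_quadFun a) hQ2 hHi hker).trans
    (ENNReal.ofReal_le_ofReal habs), (totalVariationDist_gaussian_le (measurable_quadFun a) hHi
    hker).trans (ENNReal.ofReal_le_ofReal ?_)⟩
  simp only [Pi.sub_apply] at habs
  linarith

end

end SteinQuadForm

theorem corollary7p4 {Ω : Type*} [MeasurableSpace Ω] (P : Measure Ω) [IsProbabilityMeasure P]
    (X : ℕ → Ω → ℝ) (hindep : iIndepFun X P) (hident : ∀ k, IdentDistrib (X k) (X 0) P P)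
    (hmean : ∫ ω, X 0 ω ∂P = 0) (hvar : ∫ ω, X 0 ω ^ 2 ∂P = 1)
    (hsmooth : ContDiffOn ℝ 1 (SteinQuadForm.quantile (P.map (X 0))) (Set.Ioo 0 1))
    (n : ℕ) (a : Matrix (Fin n) (Fin n) ℝ) (hsymm : a.IsSymm) (hdiag : ∀ k, a k k = 0)
    (hnorm : ∫ ω, SteinQuadForm.quadForm a X ω ^ 2 ∂P = 1) :
    SteinQuadForm.wassersteinDist (P.map (SteinQuadForm.quadForm a X)) (gaussianReal 0 1)
        ≤ 4 * SteinQuadForm.boundRoot (P.map (X 0)) a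
    ∧ SteinQuadForm.totalVariationDist (P.map (SteinQuadForm.quadForm a X)) (gaussianReal 0 1)
        ≤ 8 * SteinQuadForm.boundRoot (P.map (X 0)) a := by
  have hm : ∀ k, AEMeasurable (X k) P := fun k => (hident k).aemeasurable_fst
  have hμ : IsProbabilityMeasure (P.map (X 0)) := Measure.isProbabilityMeasure_map (hm 0)
  have hlaw : P.map (fun ω (i : Fin n) => X i ω) = Measure.pi fun _ : Fin n => P.map (X 0) := by
    rw [(iIndepFun_iff_map_fun_eq_pi_map fun i : Fin n => hm i).1
      (hindep.precomp Fin.val_injective)]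
    congr 1
    ext1 i
    exact (hident i).map_eq
  have hvec : AEMeasurable (fun ω (i : Fin n) => X i ω) P :=
    aemeasurable_pi_lambda _ fun i => hm i
  have hQ := SteinQuadForm.measurable_quadFun a
  have hmap : P.map (SteinQuadForm.quadForm a X)
      = (Measure.pi fun _ : Fin n => P.map (X 0)).map (SteinQuadForm.quadFun a) := by
    rw [← hlaw, AEMeasurable.map_map_of_aemeasurable hQ.aemeasurable hvec]
    rfl
  rw [hmap]
  refine SteinQuadForm.quadFun_gaussian_bounds hsmooth ?_ ?_ hsymm hdiag ?_
  · rw [integral_map (hm 0) (by fun_prop), hmean]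
  · rw [integral_map (hm 0) (by fun_prop), hvar]
  · rw [← hlaw, integral_map hvec (hQ.pow_const 2).aestronglyMeasurable]
    exact hnorm
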